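/- Let $n_t,n_r,T\ge 1$ be integers and consider the slow fading MIMO channel $\mathbf Y=\mathbf H\mathbf X+\mathbf W$ over a block of $T$ symbols, where the random matrix $\mathbf H\in\mathbb C^{n_r\times n_t}$ is known at the receiver and is independent of $\mathbf W\in\mathbb C^{n_r\times T}$, which has i.i.d. $\mathcal{CN}(0,1)$ entries. Let $\mathsf{SNR}_k>0$ be a sequence with $\mathsf{SNR}_k\to\infty$, and for each $k$ let $C_k$ be a nonempty finite code of matrices $\mathbf X\in\mathbb C^{n_t\times T}$ with $\|\mathbf X\|_F^2\le T\,n_t\,\mathsf{SNR}_k$ and rate $R_k=\frac1T\log_2|C_k|$ bits per symbol, such that $R_k/\log_2\mathsf{SNR}_k\to r$ with $0<r<\min(n_r,n_t)$. (Codes are indexed families of codewords.) Let $\mathbb P_e^{(k)}$ be the error probability of $C_k$ under maximum likelihood decoding, averaged over uniformly distributed messages, the fading and the noise. For a fading distribution (a probability law of $\mathbf H$), let $$d_{\rm out}(\rho)=\lim_{\mathsf{SNR}\to\infty}\frac{-\log\mathbb P\{\log\det(\mathbf I+\mathsf{SNR}\,\mathbf H\mathbf H^*)<\rho\log\mathsf{SNR}\}}{\log\mathsf{SNR}}\in[0,\infty]$$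 whenever the limit exists (with $-\log 0=\infty$). The sequence $(C_k)$ is called approximately universal over the $n_t\times n_r$ MIMO channel if, for every fading distribution for which $d_{\rm out}$ exists in a neighbourhood of $r$ and is continuous at $r$, $$\lim_{k\to\infty}\frac{-\log\mathbb P_e^{(k)}}{\log\mathsf{SNR}_k}=d_{\rm out}(r).$$ Theorem. The sequence $(C_k)$ is approximately universal over the $n_t\times n_r$ MIMO channel if and only if there is a sequence $e_k=o(\log\mathsf{SNR}_k)$ such that, for all sufficiently large $k$ and every pair of codewords $\mathbf X_A,\mathbf X_B$ of $C_k$ with distinct indices, $$\lambda_1^2\lambda_2^2\cdots\lambda_{\min(n_r,n_t)}^2\ \ge\ \frac1{2^{R_k+e_k}},$$ where $\lambda_1\le\dots\le\lambda_{n_t}$ are the singular values (the square roots of the eigenvalues of $\mathbf D\mathbf D^*$) of the normalized codeword difference matrix $\mathbf D=\frac1{\sqrt{\mathsf{SNR}_k}}(\mathbf X_A-\mathbf X_B)$, so that the product runs over the $\min(n_r,n_t)$ smallest ones. -/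

import Mathlib

open Filter Topology MeasureTheory ProbabilityTheory Asymptotics
open scoped ENNReal NNReal Matrix

noncomputable section

namespace MIMO

/-- The Borel sigma-algebra on complex matrices (entrywise product sigma-algebra). -/
instance instMeasurableSpaceMatrix (m n : ℕ) : MeasurableSpace (Matrix (Fin m) (Fin n) ℂ) :=
  inferInstanceAs (MeasurableSpace (Fin m → Fin n → ℂ))

/-- Squared Frobenius norm. -/
def frobSq {m n : ℕ} (A : Matrix (Fin m) (Fin n) ℂ) : ℝ := ∑ i, ∑ j, ‖A i j‖ ^ 2

/-- The circularly symmetric complex Gaussian law `CN(0,1)`: independent real and imaginary parts,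
each `N(0, 1/2)`. -/
def complexGaussian : Measure ℂ :=
  ((gaussianReal 0 (1 / 2)).prod (gaussianReal 0 (1 / 2))).map
    (fun p : ℝ × ℝ => (⟨p.1, p.2⟩ : ℂ))

/-- Law of the additive noise over a block of `T` symbols: i.i.d. `CN(0,1)` entries. -/
def noise (nr T : ℕ) : Measure (Matrix (Fin nr) (Fin T) ℂ) :=
  (Measure.pi fun _ : Fin nr => Measure.pi fun _ : Fin T => complexGaussian :
    Measure (Fin nr → Fin T → ℂ))

/-- A (nonempty, finite) space-time block code for `nt` transmit antennas and block length `T`. -/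
structure Code (nt T : ℕ) where
  /-- number of codewords -/
  size : ℕ
  size_pos : 0 < size
  /-- the codeword matrices -/
  word : Fin size → Matrix (Fin nt) (Fin T) ℂ

namespace Code

variable {nt T : ℕ}

/-- Rate in bits per symbol: the code has `2 ^ (T * rate)` codewords. -/
def rate (C : Code nt T) : ℝ := Real.logb 2 C.size / T

/-- The power constraint `T * nt * SNR` on every codeword. -/
def PowerConstraint (C : Code nt T) (snr : ℝ) : Prop :=
  ∀ m, frobSq (C.word m) ≤ T * nt * snr

theorem exists_nearest (C : Code nt T) {nr : ℕ} (H : Matrix (Fin nr) (Fin nt) ℂ)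
    (Y : Matrix (Fin nr) (Fin T) ℂ) :
    (Finset.univ.filter fun m : Fin C.size =>
      ∀ m', frobSq (Y - H * C.word m) ≤ frobSq (Y - H * C.word m')).Nonempty := by
  have : Nonempty (Fin C.size) := ⟨⟨0, C.size_pos⟩⟩
  obtain ⟨m, hm⟩ := Finite.exists_min (fun m : Fin C.size => frobSq (Y - H * C.word m))
  exact ⟨m, by simpa using hm⟩

/-- Maximum likelihood decoding with receiver channel knowledge. For white Gaussian noise this is
minimum distance decoding; ties (which do not affect the average error probability) are broken in
favour of the smallest index. -/
def mlDecode (C : Code nt T) {nr : ℕ} (H : Matrix (Fin nr) (Fin nt) ℂ)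
    (Y : Matrix (Fin nr) (Fin T) ℂ) : Fin C.size :=
  (Finset.univ.filter fun m : Fin C.size =>
    ∀ m', frobSq (Y - H * C.word m) ≤ frobSq (Y - H * C.word m')).min' (C.exists_nearest H Y)

/-- Error probability with ML decoding over the slow fading channel `Y = H X + W`, averaged over
uniformly distributed messages, the fading law `μ` of `H`, and the independent noise `W`. -/
def errorProb (C : Code nt T) {nr : ℕ} (μ : Measure (Matrix (Fin nr) (Fin nt) ℂ)) : ℝ≥0∞ :=
  (∑ m, (μ.prod (noise nr T)) {p | C.mlDecode p.1 (p.1 * C.word m + p.2) ≠ m}) / C.size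

/-- The codeword difference matrix normalized by `1 / √SNR`. -/
def normDiff (C : Code nt T) (snr : ℝ) (a b : Fin C.size) : Matrix (Fin nt) (Fin T) ℂ :=
  ((1 / √snr : ℝ) : ℂ) • (C.word a - C.word b)

end Code

/-- The `ℓ`-th smallest (`ℓ = 1, …, nt`) of the `nt` singular values of an `nt × T` matrix `D`, i.e.
of the square roots of the eigenvalues of `D * Dᴴ`. They are read off the decreasing sequence of
singular values of `Dᴴ : ℂ^nt → ℂ^T`. -/
def smallSingVal {nt T : ℕ} (D : Matrix (Fin nt) (Fin T) ℂ) (l : ℕ) : ℝ :=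
  (Matrix.toEuclideanLin Dᴴ).singularValues (nt - l)

/-- Probability of outage at multiplexing gain `r`:
the law of `H` evaluated on `log det (I + SNR H Hᴴ) < r log SNR`. -/
def outageProb {nr nt : ℕ} (μ : Measure (Matrix (Fin nr) (Fin nt) ℂ)) (r snr : ℝ) : ℝ≥0∞ :=
  μ {H | Real.logb 2 ((1 + (snr : ℂ) • (H * Hᴴ)).det.re) < r * Real.logb 2 snr}

/-- `-log p / log SNR`, with value `∞` for `p = 0` (for `SNR > 1`). The base of the logarithms is
irrelevant for the quotient. -/
def decayExponent (p : ℝ≥0∞) (snr : ℝ) : EReal :=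
  -ENNReal.log p / ((Real.log snr : ℝ) : EReal)

/-- The outage curve of the fading law `μ` exists at `r` and has the value `d` there. -/
def HasOutageExponent {nr nt : ℕ} (μ : Measure (Matrix (Fin nr) (Fin nt) ℂ)) (r : ℝ)
    (d : EReal) : Prop :=
  Tendsto (fun snr : ℝ => decayExponent (outageProb μ r snr) snr) atTop (𝓝 d)

/-- The sequence of codes `C k`, used at signal-to-noise ratio `snr k`, achieves diversity gain `d`
over the channel with fading law `μ`. -/
def HasDiversityGain {nr nt T : ℕ} (snr : ℕ → ℝ) (C : ℕ → Code nt T)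
    (μ : Measure (Matrix (Fin nr) (Fin nt) ℂ)) (d : EReal) : Prop :=
  Tendsto (fun k => decayExponent ((C k).errorProb μ) (snr k)) atTop (𝓝 d)

/-- The sequence of codes `C k`, of multiplexing gain `r`, is approximately universal over the
`nr × nt` channel: for every fading distribution whose outage curve `dout` is defined near `r` and
continuous at `r`, it achieves the diversity gain `dout r`. -/
def ApproximatelyUniversal {nt T : ℕ} (nr : ℕ) (snr : ℕ → ℝ) (C : ℕ → Code nt T) (r : ℝ) : Prop :=
  ∀ μ : Measure (Matrix (Fin nr) (Fin nt) ℂ), IsProbabilityMeasure μ →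
    ∀ dout : ℝ → EReal, (∀ᶠ ρ in 𝓝 r, HasOutageExponent μ ρ (dout ρ)) → ContinuousAt dout r →
      HasDiversityGain snr C μ (dout r)

end MIMO

end

/-! Everything is measured up to subpolynomial factors in `s = SNR`, so constants, and powers
absorbed by exponent slack, do not matter. Put `n = min nr nt`.

No code beats outage. Choose `L` with `L Lᴴ = 1 + s H Hᴴ`. All typical received matrices lie in the
image under `L` of a fixed ball, of volume a constant times `det(1 + s H Hᴴ) ^ T`. A channel in
outage at some `ρ < r` therefore has no room for `2 ^ (R T)` disjoint decoding regions of useful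
volume, and the error probability given this channel is at least one half
(`exists_half_le_condErrorProb`).

The criterion suffices. The overlaps of the eigenbases of `Hᴴ H` and `D Dᴴ` form a doubly stochastic
matrix, and AM-GM gives `s ‖H D‖² + ‖D‖² ≥ n (det(1 + s H Hᴴ) · λ₁² ⋯ λₙ²) ^ (1/n)`
(`mul_rpow_det_mul_prod_le`). Off outage at some `ρ > r` all codewords are thus received at squared
distance at least a positive power of `s`. Confusing them needs noise of that size, whose
probability decays faster than any power of `s`. Continuity of the outage curve at `r` lets `ρ` tend
to `r` in both directions.

The criterion is necessary. If it fails by a power of `s` infinitely often, each bad pair has a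
channel that inverts its `n` weakest directions: the pair is received at bounded distance, while the
channel stays out of outage at all powers down to `s ^ (1/κ)` for some `κ > 1`
(`exists_aligned_channel`, `exists_indistinguishing_channel`). Give these channels point masses of
order at least `s ^ (-(A+1))` inside a scalar fading law of known exponent. They reach the outage
probability at power `t` only through `t ^ (-κ A)`, but the error probability at `s` with a loss of
at most `1/|C|`, also a power of `s`. For large `A` the gain `κ > 1` wins: the outage curve is
unchanged and the error probability is too large (`not_approximatelyUniversal_of_frequently`). -/

namespace MIMO

/-! ### Spectral decompositions and Frobenius norms. -/

open Matrix in
/-- Spectral decomposition of `Aᴴ * A` with the eigenvalues in decreasing order. -/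
theorem exists_conjTranspose_mul_self_eq {m n : ℕ} (A : Matrix (Fin m) (Fin n) ℂ) :
    ∃ V ∈ Matrix.unitaryGroup (Fin n) ℂ, Aᴴ * A =
      V * Matrix.diagonal (fun j : Fin n =>
        (((Matrix.toEuclideanLin A).singularValues j ^ 2 : ℝ) : ℂ)) * Vᴴ := by
  set f := Matrix.toEuclideanLin A with hf
  have hn : Module.finrank ℂ (EuclideanSpace ℂ (Fin n)) = n := by simp
  let v := f.isSymmetric_adjoint_comp_self.eigenvectorBasis hn
  let V := (EuclideanSpace.basisFun (Fin n) ℂ).toBasis.toMatrix v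
  have hV : V ∈ Matrix.unitaryGroup (Fin n) ℂ :=
    (EuclideanSpace.basisFun (Fin n) ℂ).toMatrix_orthonormalBasis_mem_unitary v
  refine ⟨V, hV, ?_⟩
  have hVV : V * Vᴴ = 1 := Matrix.mem_unitaryGroup_iff.mp hV
  have key : Aᴴ * A * V = V * Matrix.diagonal (fun j : Fin n =>
        ((f.singularValues j ^ 2 : ℝ) : ℂ)) := by
    ext i j
    have h := f.isSymmetric_adjoint_comp_self.apply_eigenvectorBasis hn j
    rw [← f.sq_singularValues_fin hn j] at h
    have h2 := congrArg (fun x : EuclideanSpace ℂ (Fin n) => x i) h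
    rw [Matrix.mul_diagonal, mul_comm]
    have hVk : ∀ k, V k j = v j k := fun k => by
      simp [V, Module.Basis.toMatrix_apply]
    rw [hVk]
    have h3 (x) : f.adjoint x = Matrix.toEuclideanLin Aᴴ x := by
      rw [Matrix.toEuclideanLin_conjTranspose_eq_adjoint A]
    have h4 : (Aᴴ * A * V) i j = (f.adjoint (f (v j))) i := by
      rw [h3, hf, Matrix.toLpLin_apply, Matrix.toLpLin_apply]
      simp only [Matrix.mulVec_mulVec]
      rw [Matrix.mul_apply, Matrix.mulVec, dotProduct]
      simp [hVk]
    rw [h4]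
    exact h2
  rw [← key, Matrix.mul_assoc, hVV, Matrix.mul_one]

theorem frobSq_nonneg {m n : ℕ} (A : Matrix (Fin m) (Fin n) ℂ) : 0 ≤ frobSq A :=
  Finset.sum_nonneg fun _ _ => Finset.sum_nonneg fun _ _ => by positivity

theorem ofReal_frobSq {m n : ℕ} (A : Matrix (Fin m) (Fin n) ℂ) :
    ((frobSq A : ℝ) : ℂ) = (A * Aᴴ).trace := by
  simp only [frobSq, Matrix.trace, Matrix.diag, Matrix.mul_apply, Matrix.conjTranspose_apply]
  push_cast
  refine Finset.sum_congr rfl fun i _ => Finset.sum_congr rfl fun j _ => ?_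
  simpa using (Complex.mul_conj' (A i j)).symm

theorem ofReal_frobSq' {m n : ℕ} (A : Matrix (Fin m) (Fin n) ℂ) :
    ((frobSq A : ℝ) : ℂ) = (Aᴴ * A).trace := by
  rw [ofReal_frobSq, Matrix.trace_mul_comm]

theorem frobSq_smul {m n : ℕ} (c : ℂ) (A : Matrix (Fin m) (Fin n) ℂ) :
    frobSq (c • A) = ‖c‖ ^ 2 * frobSq A := by
  simp [frobSq, Finset.mul_sum, mul_pow]

theorem frobSq_sub_le {m n : ℕ} (A B : Matrix (Fin m) (Fin n) ℂ) :
    frobSq (A - B) ≤ 2 * frobSq A + 2 * frobSq B := by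
  simp only [frobSq, Finset.mul_sum, ← Finset.sum_add_distrib]
  refine Finset.sum_le_sum fun i _ => Finset.sum_le_sum fun j _ => ?_
  have h := norm_sub_le (A i j) (B i j)
  have := norm_nonneg (A i j - B i j)
  simp only [Matrix.sub_apply]
  nlinarith [sq_nonneg (‖A i j‖ - ‖B i j‖)]

theorem frobSq_neg {m n : ℕ} (A : Matrix (Fin m) (Fin n) ℂ) : frobSq (-A) = frobSq A := by
  simp [frobSq]

/-- Expand `0 ≤ frobSq (A - B)`. -/
theorem two_mul_re_trace_le {m n : ℕ} (A B : Matrix (Fin m) (Fin n) ℂ) :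
    2 * (Aᴴ * B).trace.re ≤ frobSq A + frobSq B := by
  have h : ((frobSq (A - B) : ℝ) : ℂ) =
      (frobSq A : ℂ) + frobSq B - ((Aᴴ * B).trace + star (Aᴴ * B).trace) := by
    rw [← Matrix.trace_conjTranspose, ofReal_frobSq', ofReal_frobSq', ofReal_frobSq',
      ← Matrix.trace_add, ← Matrix.trace_add, ← Matrix.trace_sub]
    congr 1
    simp only [Matrix.conjTranspose_sub, Matrix.conjTranspose_mul,
      Matrix.conjTranspose_conjTranspose]
    rw [Matrix.sub_mul, Matrix.mul_sub, Matrix.mul_sub]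
    abel
  have h2 := congrArg Complex.re h
  simp at h2
  have := frobSq_nonneg (A - B)
  linarith

/-- If `L * Lᴴ = 1 + s • H * Hᴴ`, the channel output `H * X + W` is the image under `L` of a matrix
whose Frobenius norm is controlled by those of `X` and `W`. -/
theorem frobSq_preimage_le {nr nt T : ℕ} {s : ℝ} (hs : 0 < s) (H : Matrix (Fin nr) (Fin nt) ℂ)
    (L : Matrix (Fin nr) (Fin nr) ℂ) (hL : L * Lᴴ = 1 + (s : ℂ) • (H * Hᴴ)) (hdet : IsUnit L.det)
    (X : Matrix (Fin nt) (Fin T) ℂ) (W Z : Matrix (Fin nr) (Fin T) ℂ) (hZ : L * Z = H * X + W) :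
    frobSq Z ≤ frobSq X / s + frobSq W := by
  -- Duality: `‖Z‖²` equals both `‖z‖² + s ‖Hᴴ z‖²` and `⟨Hᴴ z, X⟩ + ⟨z, W⟩`. Bounding the two inner
  -- products by Young's inequality, with weights `√s` and `1/√s` in the first, returns half of
  -- `‖Z‖²`, which is absorbed on the left.
  set z := (Lᴴ)⁻¹ * Z with hz
  have hdet' : IsUnit (Lᴴ).det := by
    rw [Matrix.det_conjTranspose]; exact hdet.star
  have hLz : Lᴴ * z = Z := by
    rw [hz, ← Matrix.mul_assoc, Matrix.mul_nonsing_inv _ hdet', Matrix.one_mul]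
  have h1 : frobSq Z = frobSq z + s * frobSq (Hᴴ * z) := by
    apply Complex.ofReal_injective
    push_cast
    rw [ofReal_frobSq', ofReal_frobSq', ofReal_frobSq']
    have : Zᴴ * Z = zᴴ * (1 + (s : ℂ) • (H * Hᴴ)) * z := by
      rw [← hL, ← hLz]; simp [Matrix.mul_assoc]
    rw [this]
    simp [Matrix.mul_add, Matrix.add_mul, Matrix.mul_assoc, Matrix.trace_add]
  have h2 : (frobSq Z : ℂ) = ((Hᴴ * z)ᴴ * X).trace + (zᴴ * W).trace := by
    rw [ofReal_frobSq', ← Matrix.trace_add]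
    congr 1
    have : (Hᴴ * z)ᴴ * X + zᴴ * W = zᴴ * (H * X + W) := by
      simp [Matrix.mul_add, Matrix.mul_assoc]
    rw [this, ← hZ]
    nth_rw 1 [← hLz]
    simp [Matrix.mul_assoc]
  have h2' := congrArg Complex.re h2
  simp only [Complex.ofReal_re, Complex.add_re] at h2'
  have h3 := two_mul_re_trace_le z W
  have h4 := two_mul_re_trace_le ((√s : ℂ) • (Hᴴ * z)) ((√s : ℂ)⁻¹ • X)
  have hs' : (√s : ℂ) ≠ 0 := by
    exact_mod_cast (Real.sqrt_pos.mpr hs).ne'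
  rw [frobSq_smul, frobSq_smul] at h4
  have e1 : ((√s : ℂ) • (Hᴴ * z))ᴴ * ((√s : ℂ)⁻¹ • X) = (Hᴴ * z)ᴴ * X := by
    rw [Matrix.conjTranspose_smul, Matrix.smul_mul, Matrix.mul_smul, smul_smul]
    simp [hs']
  have e2 : ‖(√s : ℂ)‖ ^ 2 = s := by
    rw [Complex.norm_real, Real.norm_of_nonneg (Real.sqrt_nonneg s), Real.sq_sqrt hs.le]
  rw [e1, norm_inv, inv_pow, e2] at h4
  rw [div_eq_inv_mul]
  linarith

theorem det_one_add_smul_mul_conjTranspose {m n : ℕ} (A : Matrix (Fin m) (Fin n) ℂ) (s : ℝ) :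
    (1 + (s : ℂ) • (Aᴴ * A)).det =
      ((∏ j : Fin n, (1 + s * (Matrix.toEuclideanLin A).singularValues j ^ 2) : ℝ) : ℂ) := by
  obtain ⟨V, hV, h⟩ := exists_conjTranspose_mul_self_eq A
  have hVV : V * Vᴴ = 1 := Matrix.mem_unitaryGroup_iff.mp hV
  have hVV' : Vᴴ * V = 1 := Matrix.mem_unitaryGroup_iff'.mp hV
  set d := Matrix.diagonal (fun j : Fin n =>
        (((Matrix.toEuclideanLin A).singularValues j ^ 2 : ℝ) : ℂ)) with hd
  have h1 : 1 + (s : ℂ) • (Aᴴ * A) = V * (1 + (s : ℂ) • d) * Vᴴ := by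
    rw [h]; simp [Matrix.mul_add, Matrix.add_mul, hVV]
  rw [h1, Matrix.det_mul_right_comm, hVV, Matrix.one_mul]
  have h2 : 1 + (s : ℂ) • d = Matrix.diagonal (fun j : Fin n =>
        ((1 + s * (Matrix.toEuclideanLin A).singularValues j ^ 2 : ℝ) : ℂ)) := by
    rw [hd, ← Matrix.diagonal_one, ← Matrix.diagonal_smul, Matrix.diagonal_add]
    congr 1; ext j; simp
  rw [h2, Matrix.det_diagonal]
  push_cast; rfl

theorem det_one_add_comm {m n : ℕ} (A : Matrix (Fin m) (Fin n) ℂ) (s : ℂ) :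
    (1 + s • (A * Aᴴ)).det = (1 + s • (Aᴴ * A)).det := by
  rw [← Matrix.smul_mul, Matrix.det_one_add_mul_comm, Matrix.mul_smul]

/-- Sylvester's identity moves the determinant to the transmit side, so that its factors can be
paired with the spectrum of `D Dᴴ`. Directions in the kernel of `H` contribute factors `1`. -/
theorem det_one_add_smul_eq {nr nt : ℕ} (H : Matrix (Fin nr) (Fin nt) ℂ) (s : ℝ) :
    (1 + (s : ℂ) • (H * Hᴴ)).det.re =
      ∏ j : Fin nt, (1 + s * (Matrix.toEuclideanLin H).singularValues j ^ 2) := by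
  rw [det_one_add_comm, det_one_add_smul_mul_conjTranspose, Complex.ofReal_re]

theorem one_le_det_one_add {nr nt : ℕ} (H : Matrix (Fin nr) (Fin nt) ℂ) {s : ℝ} (hs : 0 ≤ s) :
    1 ≤ (1 + (s : ℂ) • (H * Hᴴ)).det.re := by
  rw [det_one_add_smul_eq]
  have : ∏ j : Fin nt, (1 : ℝ) ≤
      ∏ j : Fin nt, (1 + s * (Matrix.toEuclideanLin H).singularValues j ^ 2) :=
    Finset.prod_le_prod (fun _ _ => zero_le_one) fun j _ => by
      have : 0 ≤ s * (Matrix.toEuclideanLin H).singularValues j ^ 2 := by positivity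
      linarith
  simpa using this

/-- A square root of `1 + s • H * Hᴴ`. -/
theorem exists_mul_conjTranspose_eq {nr nt : ℕ} (H : Matrix (Fin nr) (Fin nt) ℂ) {s : ℝ}
    (hs : 0 ≤ s) : ∃ L : Matrix (Fin nr) (Fin nr) ℂ, L * Lᴴ = 1 + (s : ℂ) • (H * Hᴴ) ∧
      ‖L.det‖ ^ 2 = (1 + (s : ℂ) • (H * Hᴴ)).det.re ∧ IsUnit L.det := by
  obtain ⟨U, hU, h⟩ := exists_conjTranspose_mul_self_eq Hᴴ
  have hUU : U * Uᴴ = 1 := Matrix.mem_unitaryGroup_iff.mp hU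
  rw [Matrix.conjTranspose_conjTranspose] at h
  set q : Fin nr → ℝ := fun j => (Matrix.toEuclideanLin Hᴴ).singularValues j ^ 2 with hq
  set e : Matrix (Fin nr) (Fin nr) ℂ := Matrix.diagonal fun j => ((√(1 + s * q j) : ℝ) : ℂ) with he
  have hee : e * eᴴ = 1 + (s : ℂ) • Matrix.diagonal (fun j => (q j : ℂ)) := by
    rw [he, Matrix.diagonal_conjTranspose, Matrix.diagonal_mul_diagonal, ← Matrix.diagonal_one,
      ← Matrix.diagonal_smul, Matrix.diagonal_add]
    congr 1; ext j
    have : 0 ≤ 1 + s * q j := by positivity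
    simp only [Pi.star_apply, Complex.star_def, Complex.conj_ofReal, ← Complex.ofReal_mul,
      Real.mul_self_sqrt this]
    simp
  have hL : (U * e) * (U * e)ᴴ = 1 + (s : ℂ) • (H * Hᴴ) := by
    rw [Matrix.conjTranspose_mul, h]
    calc U * e * (eᴴ * Uᴴ) = U * (e * eᴴ) * Uᴴ := by simp [Matrix.mul_assoc]
      _ = _ := by rw [hee]; simp [Matrix.mul_add, Matrix.add_mul, hUU, hq]
  have hdet : ‖(U * e).det‖ ^ 2 = (1 + (s : ℂ) • (H * Hᴴ)).det.re := by
    rw [← hL, Matrix.det_mul _ (U * e)ᴴ, Matrix.det_conjTranspose, Complex.star_def,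
      Complex.mul_conj', ← Complex.ofReal_pow, Complex.ofReal_re]
  refine ⟨U * e, hL, hdet, ?_⟩
  rw [isUnit_iff_ne_zero]
  intro h0
  rw [h0, norm_zero, zero_pow two_ne_zero] at hdet
  have := one_le_det_one_add H hs
  linarith

/-! ### Received distance of a codeword pair: universal lower bound and aligned channel. -/

/-- `‖A * D‖²` in terms of the spectra of `Aᴴ * A` and `D * Dᴴ`. -/
theorem exists_frobSq_mul_eq {nr nt T : ℕ} (H : Matrix (Fin nr) (Fin nt) ℂ)
    (D : Matrix (Fin nt) (Fin T) ℂ) :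
    ∃ p : Fin nt → Fin nt → ℝ, (∀ i j, 0 ≤ p i j) ∧ (∀ i, ∑ j, p i j = 1) ∧
      (∀ j, ∑ i, p i j = 1) ∧ frobSq D = ∑ i, ∑ j : Fin nt, p i j *
        (Matrix.toEuclideanLin Dᴴ).singularValues j ^ 2 ∧
      frobSq (H * D) = ∑ i : Fin nt, (Matrix.toEuclideanLin H).singularValues i ^ 2 *
        ∑ j : Fin nt, p i j *
        (Matrix.toEuclideanLin Dᴴ).singularValues j ^ 2 := by
  obtain ⟨V, hV, hH⟩ := exists_conjTranspose_mul_self_eq H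
  obtain ⟨U, hU, hD⟩ := exists_conjTranspose_mul_self_eq Dᴴ
  rw [Matrix.conjTranspose_conjTranspose] at hD
  have hVV : V * Vᴴ = 1 := Matrix.mem_unitaryGroup_iff.mp hV
  have hVV' : Vᴴ * V = 1 := Matrix.mem_unitaryGroup_iff'.mp hV
  have hUU : U * Uᴴ = 1 := Matrix.mem_unitaryGroup_iff.mp hU
  have hUU' : Uᴴ * U = 1 := Matrix.mem_unitaryGroup_iff'.mp hU
  -- The change of basis between the two eigenbases is unitary, so its squared moduli are doubly
  -- stochastic.
  set w := Vᴴ * U with hw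
  have hww : w * wᴴ = 1 := by
    rw [hw, Matrix.conjTranspose_mul, Matrix.conjTranspose_conjTranspose, Matrix.mul_assoc,
      ← Matrix.mul_assoc U, hUU, Matrix.one_mul, hVV']
  have hww' : wᴴ * w = 1 := by
    rw [hw, Matrix.conjTranspose_mul, Matrix.conjTranspose_conjTranspose, Matrix.mul_assoc,
      ← Matrix.mul_assoc V, hVV, Matrix.one_mul, hUU']
  set q : Fin nt → ℝ := fun j => (Matrix.toEuclideanLin Dᴴ).singularValues j ^ 2 with hq
  set μ : Fin nt → ℝ := fun j => (Matrix.toEuclideanLin H).singularValues j ^ 2 with hμ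
  have key : ∀ i, (w * Matrix.diagonal (fun j => (q j : ℂ)) * wᴴ) i i =
      ((∑ j, ‖w i j‖ ^ 2 * q j : ℝ) : ℂ) := by
    intro i
    rw [Matrix.mul_apply]
    push_cast
    refine Finset.sum_congr rfl fun j _ => ?_
    rw [Matrix.mul_diagonal, Matrix.conjTranspose_apply, mul_right_comm, Complex.star_def,
      Complex.mul_conj']
  refine ⟨fun i j => ‖w i j‖ ^ 2, fun i j => by positivity, fun i => ?_, fun j => ?_, ?_, ?_⟩
  · have := congrFun (congrFun hww i) i
    rw [Matrix.mul_apply, Matrix.one_apply_eq] at this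
    simp only [Matrix.conjTranspose_apply, Complex.star_def, Complex.mul_conj'] at this
    exact_mod_cast this
  · have := congrFun (congrFun hww' j) j
    rw [Matrix.mul_apply, Matrix.one_apply_eq] at this
    simp only [Matrix.conjTranspose_apply, Complex.star_def, Complex.conj_mul'] at this
    exact_mod_cast this
  · apply Complex.ofReal_injective
    rw [ofReal_frobSq, hD]
    have : (U * Matrix.diagonal (fun j => (q j : ℂ)) * Uᴴ).trace =
        (w * Matrix.diagonal (fun j => (q j : ℂ)) * wᴴ).trace := by
      rw [Matrix.trace_mul_comm, Matrix.trace_mul_comm (w * _), ← Matrix.mul_assoc,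
        ← Matrix.mul_assoc, hww', hUU']
    rw [this, Matrix.trace, Complex.ofReal_sum]
    exact Finset.sum_congr rfl fun i _ => key i
  · apply Complex.ofReal_injective
    rw [ofReal_frobSq']
    have h1 : ((H * D)ᴴ * (H * D)).trace = (Matrix.diagonal (fun j => (μ j : ℂ)) *
        (w * Matrix.diagonal (fun j => (q j : ℂ)) * wᴴ)).trace := by
      calc ((H * D)ᴴ * (H * D)).trace = (Dᴴ * ((Hᴴ * H) * D)).trace := by
            simp [Matrix.mul_assoc]
        _ = ((Hᴴ * H) * (D * Dᴴ)).trace := by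
            rw [Matrix.trace_mul_comm, Matrix.mul_assoc]
        _ = (V * (Matrix.diagonal (fun j => (μ j : ℂ)) * (w * Matrix.diagonal (fun j => (q j : ℂ))
              * Uᴴ))).trace := by
            rw [hH, hD]; simp [hμ, hq, hw, Matrix.mul_assoc]
        _ = _ := by
            rw [Matrix.trace_mul_comm]
            simp [hw, Matrix.mul_assoc]
    rw [h1, Matrix.trace]
    push_cast
    refine Finset.sum_congr rfl fun i _ => ?_
    rw [Matrix.diag_apply, Matrix.diagonal_mul, key i]
    simp [hμ, hq]

theorem card_filter_sub_le_val {N n : ℕ} (hnN : n ≤ N) :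
    (Finset.univ.filter fun j : Fin N => N - n ≤ (j : ℕ)).card = n := by
  have h := Fin.card_filter_val_lt (n := N) (m := N - n)
  have h2 := Finset.card_filter_add_card_filter_not (s := (Finset.univ : Finset (Fin N)))
    (p := fun j : Fin N => (j : ℕ) < N - n)
  simp only [not_lt, Finset.card_univ, Fintype.card_fin] at h2
  omega

/-- A fractional sub-selection of total weight `n` from a decreasing sequence of positive numbers
has a (weighted) product at least that of the `n` smallest ones. -/
theorem prod_smallest_le_prod_rpow {N n : ℕ} (hn : 0 < n) (hnN : n ≤ N) {q : Fin N → ℝ}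
    (hq : ∀ j, 0 < q j) (hanti : Antitone q) {c : Fin N → ℝ} (hc0 : ∀ j, 0 ≤ c j)
    (hc1 : ∀ j, c j ≤ 1) (hc : ∑ j, c j = n) :
    ∏ j ∈ Finset.univ.filter (fun j : Fin N => N - n ≤ (j : ℕ)), q j ≤ ∏ j, q j ^ c j := by
  have hlt : N - n < N := by omega
  set τ := q ⟨N - n, hlt⟩ with hτ
  have hcard : ((Finset.univ.filter fun j : Fin N => N - n ≤ (j : ℕ)).card : ℝ) = n := by
    exact_mod_cast card_filter_sub_le_val hnN
  rw [← Real.log_le_log_iff (Finset.prod_pos fun j _ => hq j)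
    (Finset.prod_pos fun j _ => Real.rpow_pos_of_pos (hq j) _),
    Real.log_prod fun j _ => (hq j).ne',
    Real.log_prod fun j _ => (Real.rpow_pos_of_pos (hq j) _).ne']
  simp only [Real.log_rpow (hq _)]
  rw [Finset.sum_filter]
  -- Exchange argument around the threshold `τ`, the largest of the `n` smallest values: below it `c
  -- j - 1 ≤ 0` meets a nonpositive logarithm difference, above it both factors are nonnegative. The
  -- `log τ` terms cancel because both selections have total weight `n`.
  have key : 0 ≤ ∑ j, (c j - if N - n ≤ (j : ℕ) then 1 else 0) * (Real.log (q j) - Real.log τ) := by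
    refine Finset.sum_nonneg fun j _ => ?_
    split_ifs with h
    · have : Real.log (q j) ≤ Real.log τ := Real.log_le_log (hq j) (hanti h)
      nlinarith [hc1 j]
    · have : Real.log τ ≤ Real.log (q j) :=
        Real.log_le_log (hq _) (hanti (Fin.le_def.mpr (by simpa using (not_le.mp h).le)))
      nlinarith [hc0 j]
  have e : ∑ j, (c j - if N - n ≤ (j : ℕ) then (1 : ℝ) else 0) * (Real.log (q j) - Real.log τ) =
      (∑ j, c j * Real.log (q j) - ∑ j : Fin N, if N - n ≤ (j : ℕ) then Real.log (q j) else 0)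
        - ((∑ j, c j) - ∑ j : Fin N, if N - n ≤ (j : ℕ) then (1 : ℝ) else 0) * Real.log τ := by
    rw [← Finset.sum_sub_distrib, ← Finset.sum_sub_distrib, Finset.sum_mul,
      ← Finset.sum_sub_distrib]
    refine Finset.sum_congr rfl fun j _ => ?_
    split_ifs <;> ring
  have e2 : (∑ j : Fin N, if N - n ≤ (j : ℕ) then (1 : ℝ) else 0) = n := by
    rw [← hcard, Finset.card_filter]; push_cast; rfl
  rw [e, e2, hc] at key
  linarith

/-- The arithmetic-geometric mean inequality behind the worst-case alignment of a channel and a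
codeword difference. -/
theorem mul_rpow_prod_le_sum {N n : ℕ} (hn : 0 < n) (hnN : n ≤ N) {a q : Fin N → ℝ}
    (ha : ∀ i, 0 ≤ a i) (ha1 : ∀ i : Fin N, n ≤ (i : ℕ) → a i = 1) (hq : ∀ j, 0 ≤ q j)
    (hanti : Antitone q) {p : Fin N → Fin N → ℝ} (hp : ∀ i j, 0 ≤ p i j)
    (hrow : ∀ i, ∑ j, p i j = 1) (hcol : ∀ j, ∑ i, p i j = 1) :
    n * ((∏ i, a i) * ∏ j ∈ Finset.univ.filter (fun j : Fin N => N - n ≤ (j : ℕ)), q j) ^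
      (1 / (n : ℝ)) ≤
      ∑ i, a i * ∑ j, p i j * q j := by
  have hn' : (0 : ℝ) < n := by exact_mod_cast hn
  have hsum0 : ∀ i, 0 ≤ ∑ j, p i j * q j := fun i =>
    Finset.sum_nonneg fun j _ => mul_nonneg (hp i j) (hq j)
  by_cases hz : ∏ j ∈ Finset.univ.filter (fun j : Fin N => N - n ≤ (j : ℕ)), q j = 0
  · rw [hz, mul_zero, Real.zero_rpow (by positivity), mul_zero]
    exact Finset.sum_nonneg fun i _ => mul_nonneg (ha i) (hsum0 i)
  have hqpos : ∀ j, 0 < q j := by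
    replace hz := Finset.prod_ne_zero_iff.mp hz
    intro j
    have hlast : 0 < q ⟨N - 1, by omega⟩ :=
      lt_of_le_of_ne (hq _) (Ne.symm (hz _ (by simp; omega)))
    exact hlast.trans_le (hanti (Fin.le_def.mpr (by simp; omega)))
  -- Only these `n` rows can have `a i ≠ 1`; the remaining rows are dropped from the sum at the end.
  set S := Finset.univ.filter fun i : Fin N => (i : ℕ) < n with hS
  have hcard : S.card = n := by
    rw [hS, Fin.card_filter_val_lt]; omega
  have hprodS : ∏ i, a i = ∏ i ∈ S, a i := by
    rw [hS, Finset.prod_filter]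
    refine Finset.prod_congr rfl fun i _ => ?_
    split_ifs with h
    · rfl
    · exact ha1 i (not_lt.mp h)
  have hy : ∀ i, ∏ j, q j ^ p i j ≤ ∑ j, p i j * q j := fun i =>
    Real.geom_mean_le_arith_mean_weighted _ _ _ (fun j _ => hp i j) (hrow i) fun j _ => hq j
  have hprod : ∏ j ∈ Finset.univ.filter (fun j : Fin N => N - n ≤ (j : ℕ)), q j ≤
      ∏ i ∈ S, ∑ j, p i j * q j := by
    -- The rows in `S` place on column `j` a total weight at most its column sum `1`, and `n`
    -- altogether: a fractional selection of `n` columns. AM-GM inside each row (`hy`) then passes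
    -- to the weighted sums, and a second AM-GM across `S` (`hamgm`) gives the claim.
    calc ∏ j ∈ Finset.univ.filter (fun j : Fin N => N - n ≤ (j : ℕ)), q j
        ≤ ∏ j, q j ^ (∑ i ∈ S, p i j) := by
          refine prod_smallest_le_prod_rpow hn hnN hqpos hanti
            (fun j => Finset.sum_nonneg fun i _ => hp i j) (fun j => ?_) ?_
          · rw [← hcol j]
            exact Finset.sum_le_sum_of_subset_of_nonneg (Finset.subset_univ _) fun i _ _ => hp i j
          · rw [Finset.sum_comm, Finset.sum_congr rfl fun i _ => hrow i]
            simp [hcard]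
      _ = ∏ i ∈ S, ∏ j, q j ^ p i j := by
          rw [Finset.prod_comm]
          exact Finset.prod_congr rfl fun j _ => Real.rpow_sum_of_pos (hqpos j) _ _
      _ ≤ _ := Finset.prod_le_prod
          (fun i _ => Finset.prod_nonneg fun j _ => Real.rpow_nonneg (hq j) _) fun i _ => hy i
  have hamgm := Real.geom_mean_le_arith_mean_weighted S (fun _ => 1 / (n : ℝ))
    (fun i => a i * ∑ j, p i j * q j) (fun _ _ => by positivity)
    (by rw [Finset.sum_const, hcard, nsmul_eq_mul]; field_simp)
    (fun i _ => mul_nonneg (ha i) (hsum0 i))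
  rw [Real.finsetProd_rpow _ _ (fun i _ => mul_nonneg (ha i) (hsum0 i)), ← Finset.mul_sum,
    Finset.prod_mul_distrib] at hamgm
  have h1 : ((∏ i, a i) * ∏ j ∈ Finset.univ.filter (fun j : Fin N => N - n ≤ (j : ℕ)), q j) ^
      (1 / (n : ℝ)) ≤
      ((∏ i ∈ S, a i) * ∏ i ∈ S, ∑ j, p i j * q j) ^ (1 / (n : ℝ)) := by
    rw [hprodS]
    refine Real.rpow_le_rpow ?_ ?_ (by positivity)
    · exact mul_nonneg (Finset.prod_nonneg fun i _ => ha i) (Finset.prod_nonneg fun i _ => hq i)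
    · exact mul_le_mul_of_nonneg_left hprod (Finset.prod_nonneg fun i _ => ha i)
  have h2 : ∑ i ∈ S, (a i * ∑ j, p i j * q j) ≤ ∑ i, a i * ∑ j, p i j * q j :=
    Finset.sum_le_sum_of_subset_of_nonneg (Finset.subset_univ _) fun i _ _ =>
      mul_nonneg (ha i) (hsum0 i)
  have h3 := h1.trans hamgm
  calc (n : ℝ) * _ ≤ n * (1 / n * ∑ i ∈ S, (a i * ∑ j, p i j * q j)) :=
        mul_le_mul_of_nonneg_left h3 hn'.le
    _ = ∑ i ∈ S, (a i * ∑ j, p i j * q j) := by field_simp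
    _ ≤ _ := h2

theorem prod_smallSingVal {nt T : ℕ} (D : Matrix (Fin nt) (Fin T) ℂ) {n : ℕ} (hn : n ≤ nt) :
    ∏ l ∈ Finset.Icc 1 n, smallSingVal D l ^ 2 =
      ∏ j ∈ Finset.univ.filter (fun j : Fin nt => nt - n ≤ (j : ℕ)),
        (Matrix.toEuclideanLin Dᴴ).singularValues j ^ 2 := by
  symm
  refine Finset.prod_bij (fun (j : Fin nt) _ => nt - (j : ℕ)) ?_ ?_ ?_ ?_
  · intro j hj
    have := j.2
    simp at hj ⊢
    omega
  · intro i hi j hj h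
    have := i.2; have := j.2
    ext
    omega
  · intro l hl
    simp only [Finset.mem_Icc] at hl
    exact ⟨⟨nt - l, by omega⟩, by simp; omega, by simp; omega⟩
  · intro j hj
    have := j.2
    rw [smallSingVal]
    congr 3
    omega

/-- Universal lower bound on the received distance of a codeword pair. -/
theorem mul_rpow_det_mul_prod_le {nr nt T : ℕ} (hn : 0 < min nr nt)
    (H : Matrix (Fin nr) (Fin nt) ℂ) (D : Matrix (Fin nt) (Fin T) ℂ) {s : ℝ} (hs : 0 ≤ s) :
    (min nr nt : ℕ) * ((1 + (s : ℂ) • (H * Hᴴ)).det.re *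
      ∏ l ∈ Finset.Icc 1 (min nr nt), smallSingVal D l ^ 2) ^ (1 / ((min nr nt : ℕ) : ℝ)) ≤
      s * frobSq (H * D) + frobSq D := by
  obtain ⟨p, hp, hrow, hcol, hD, hHD⟩ := exists_frobSq_mul_eq H D
  rw [prod_smallSingVal D (min_le_right nr nt), det_one_add_smul_eq]
  refine (mul_rpow_prod_le_sum hn (min_le_right nr nt) (fun i => by positivity) ?_
    (fun j => by positivity) ?_ hp hrow hcol).trans_eq ?_
  · intro i hi
    have : (Matrix.toEuclideanLin H).singularValues i = 0 := by
      rw [LinearMap.singularValues_eq_zero_iff_le_finrank_range]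
      have h1 := Submodule.finrank_le (Matrix.toEuclideanLin H).range
      simp only [finrank_euclideanSpace, Fintype.card_fin] at h1
      have := i.2
      omega
    simp [this]
  · intro i j hij
    exact pow_le_pow_left₀ (LinearMap.singularValues_nonneg _ _)
      ((Matrix.toEuclideanLin Dᴴ).singularValues_antitone hij) 2
  · rw [hD, hHD, Finset.mul_sum, ← Finset.sum_add_distrib]
    refine Finset.sum_congr rfl fun i _ => by ring

/-- A channel aligned with the weakest directions of `D`. -/
theorem exists_aligned_channel {nr nt T : ℕ} (D : Matrix (Fin nt) (Fin T) ℂ) {s x : ℝ}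
    (hs : 0 < s) (hx : ∏ l ∈ Finset.Icc 1 (min nr nt), smallSingVal D l ^ 2 < x) :
    ∃ H : Matrix (Fin nr) (Fin nt) ℂ, s * frobSq (H * D) ≤ (min nr nt : ℕ) ∧
      ∀ t : ℝ, 0 ≤ t → (t / s) ^ (min nr nt) / x ≤ (1 + (t : ℂ) • (H * Hᴴ)).det.re := by
  set n := min nr nt with hn
  set q : Fin nt → ℝ := fun j => (Matrix.toEuclideanLin Dᴴ).singularValues j ^ 2 with hq
  have hq0 : ∀ j, 0 ≤ q j := fun j => by positivity
  set S := Finset.univ.filter fun j : Fin nt => nt - n ≤ (j : ℕ) with hS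
  have hcardn : S.card = n := card_filter_sub_le_val (min_le_right nr nt)
  rw [prod_smallSingVal D (min_le_right nr nt)] at hx
  -- Some singular values of `D` may vanish; the strict inequality `hx` leaves room to make all of
  -- them positive.
  obtain ⟨η, hη, hηx⟩ : ∃ η : ℝ, 0 < η ∧ ∏ j ∈ S, (q j + η) < x := by
    have hc : Tendsto (fun η : ℝ => ∏ j ∈ S, (q j + η)) (𝓝[>] 0) (𝓝 (∏ j ∈ S, (q j + 0))) :=
      ((continuous_finsetProd _ fun j _ => continuous_const.add continuous_id).tendsto
        0).mono_left nhdsWithin_le_nhds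
    simp only [add_zero] at hc
    obtain ⟨η, h1, h2⟩ := ((hc.eventually_lt_const hx).and self_mem_nhdsWithin).exists
    exact ⟨η, h2, h1⟩
  have hqη : ∀ j, 0 < q j + η := fun j => by have := hq0 j; positivity
  -- Channel inversion: each used direction contributes at most `1` to `s ‖H D‖²`, and the product
  -- of the `c j ^ 2` is `s ^ (-n)` over the product of the `q j + η`.
  set c : Fin nt → ℝ := fun j => √(1 / (s * (q j + η))) with hc
  have hc2 : ∀ j, c j ^ 2 = 1 / (s * (q j + η)) := fun j => by
    have := hqη j
    exact Real.sq_sqrt (by positivity)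
  obtain ⟨U, hU, hD⟩ := exists_conjTranspose_mul_self_eq Dᴴ
  rw [Matrix.conjTranspose_conjTranspose] at hD
  have hUU : U * Uᴴ = 1 := Matrix.mem_unitaryGroup_iff.mp hU
  have hUU' : Uᴴ * U = 1 := Matrix.mem_unitaryGroup_iff'.mp hU
  -- Antidiagonal from the last column: row `0` reads the weakest direction, since `q` is
  -- decreasing, and exactly the last `min nr nt` columns are hit whichever of `nr`, `nt` is larger.
  set G : Matrix (Fin nr) (Fin nt) ℂ := Matrix.of fun i j =>
    if (i : ℕ) + j + 1 = nt then (c j : ℂ) else 0 with hG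
  have hGG : Gᴴ * G = Matrix.diagonal fun j : Fin nt =>
      ((if nt - n ≤ (j : ℕ) then c j ^ 2 else 0 : ℝ) : ℂ) := by
    ext j k
    rw [Matrix.mul_apply]
    simp only [hG, Matrix.conjTranspose_apply, Matrix.of_apply]
    by_cases hj : nt - n ≤ (j : ℕ)
    · have hi : nt - 1 - (j : ℕ) < nr := by have := j.2; omega
      rw [Finset.sum_eq_single ⟨nt - 1 - (j : ℕ), hi⟩]
      · have hj2 := j.2
        by_cases hjk : j = k
        · subst hjk
          rw [if_pos (by simp; omega), Matrix.diagonal_apply_eq, if_pos hj]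
          simp [sq]
        · have : (j : ℕ) ≠ k := fun h => hjk (Fin.ext h)
          rw [Matrix.diagonal_apply_ne _ hjk, if_neg (c := _ + (k : ℕ) + 1 = nt)
            (by simp; omega), mul_zero]
      · intro i _ hi'
        have : (i : ℕ) ≠ nt - 1 - j := fun h => hi' (Fin.ext h)
        rw [if_neg (by omega)]
        simp
      · simp
    · rw [Finset.sum_eq_zero]
      · by_cases hjk : j = k
        · subst hjk
          rw [Matrix.diagonal_apply_eq, if_neg hj]; simp
        · rw [Matrix.diagonal_apply_ne _ hjk]
      · intro i _
        have := i.2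
        rw [if_neg (by omega)]
        simp
  refine ⟨G * Uᴴ, ?_, fun t ht => ?_⟩
  · have h1 : frobSq (G * Uᴴ * D) =
        ∑ j : Fin nt, (if nt - n ≤ (j : ℕ) then c j ^ 2 else 0) * q j := by
      apply Complex.ofReal_injective
      rw [ofReal_frobSq']
      have : ((G * Uᴴ * D)ᴴ * (G * Uᴴ * D)).trace =
          ((Gᴴ * G) * Matrix.diagonal (fun j => (q j : ℂ))).trace := by
        calc ((G * Uᴴ * D)ᴴ * (G * Uᴴ * D)).trace
            = (Dᴴ * (U * Gᴴ * G * Uᴴ * D)).trace := by simp [Matrix.mul_assoc]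
          _ = (U * Gᴴ * G * Uᴴ * (D * Dᴴ)).trace := by
              rw [Matrix.trace_mul_comm, Matrix.mul_assoc]
          _ = (U * (Gᴴ * G * (Uᴴ * U) * (Matrix.diagonal (fun j => (q j : ℂ)) * Uᴴ))).trace := by
              rw [hD]; simp only [Matrix.mul_assoc]; rfl
          _ = _ := by
              rw [hUU', Matrix.mul_one, Matrix.trace_mul_comm]
              simp only [Matrix.mul_assoc, hUU', Matrix.mul_one]
      rw [this, hGG, Matrix.diagonal_mul_diagonal, Matrix.trace_diagonal]
      push_cast
      rfl
    rw [h1, Finset.mul_sum]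
    calc ∑ j : Fin nt, s * ((if nt - n ≤ (j : ℕ) then c j ^ 2 else 0) * q j)
        ≤ ∑ j : Fin nt, if nt - n ≤ (j : ℕ) then (1 : ℝ) else 0 := by
          refine Finset.sum_le_sum fun j _ => ?_
          split_ifs
          · rw [hc2]
            have := hqη j
            have e : s * (1 / (s * (q j + η)) * q j) = q j / (q j + η) := by field_simp
            rw [e, div_le_one this]
            linarith
          · simp
      _ = (n : ℝ) := (Finset.sum_boole _ _).trans (congrArg _ hcardn)
  · have hHH : G * Uᴴ * (G * Uᴴ)ᴴ = G * Gᴴ := by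
      rw [Matrix.conjTranspose_mul, Matrix.conjTranspose_conjTranspose, Matrix.mul_assoc,
        ← Matrix.mul_assoc Uᴴ, hUU', Matrix.one_mul]
    have h2 : 1 + (t : ℂ) • (Gᴴ * G) = Matrix.diagonal fun j : Fin nt =>
        ((1 + t * (if nt - n ≤ (j : ℕ) then c j ^ 2 else 0) : ℝ) : ℂ) := by
      rw [hGG, ← Matrix.diagonal_one, ← Matrix.diagonal_smul, Matrix.diagonal_add]
      congr 1; ext j; simp [-mul_ite]
    rw [hHH, det_one_add_comm, h2, Matrix.det_diagonal, ← Complex.ofReal_prod, Complex.ofReal_re]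
    calc (t / s) ^ n / x ≤ (t / s) ^ n / ∏ j ∈ S, (q j + η) :=
          div_le_div_of_nonneg_left (by positivity) (Finset.prod_pos fun j _ => hqη j) hηx.le
      _ = ∏ j ∈ S, t * c j ^ 2 := by
          rw [← hcardn, ← Finset.prod_const,
            ← Finset.prod_div_distrib]
          refine Finset.prod_congr rfl fun j _ => ?_
          rw [hc2]
          have := hqη j
          field_simp
      _ ≤ ∏ j : Fin nt, (1 + t * (if nt - n ≤ (j : ℕ) then c j ^ 2 else 0)) := by
          rw [hS, Finset.prod_filter]
          refine Finset.prod_le_prod (fun j _ => ?_) fun j _ => ?_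
          · split_ifs <;> positivity
          · split_ifs <;> simp

/-! ### Gaussian noise compared with Lebesgue measure. -/

section Product

variable {ι : Type*} [Fintype ι] {α : ι → Type*} [∀ i, MeasurableSpace (α i)]

/-- The right side is again a product measure, with factors `c • ν i`, and the product outer measure
is the largest one bounded by the products on boxes. It carries one-dimensional density bounds over
to matrices. -/
theorem pi_le_smul_pi {μ ν : ∀ i, Measure (α i)} [∀ i, SigmaFinite (μ i)] [∀ i, SigmaFinite (ν i)]
    {c : ℝ≥0} (h : ∀ i, μ i ≤ c • ν i) :
    Measure.pi μ ≤ c ^ Fintype.card ι • Measure.pi ν := by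
  have hpi : Measure.pi (fun i => c • ν i) = c ^ Fintype.card ι • Measure.pi ν := by
    refine Measure.pi_eq fun s _ => ?_
    simp only [Measure.smul_apply, Measure.pi_pi, ENNReal.smul_def, smul_eq_mul,
      Finset.prod_mul_distrib, Finset.prod_const, Finset.card_univ]
    push_cast
    rfl
  rw [← hpi, Measure.le_iff]
  intro s hs
  have hle : (Measure.pi μ).toOuterMeasure ≤ OuterMeasure.pi fun i => (c • ν i).toOuterMeasure := by
    rw [OuterMeasure.le_pi]
    intro t _
    calc (Measure.pi μ).toOuterMeasure (Set.univ.pi t) = ∏ i, μ i (t i) := Measure.pi_pi μ t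
      _ ≤ ∏ i, (c • ν i) (t i) := Finset.prod_le_prod' fun i _ => h i (t i)
  refine (hle s).trans_eq ?_
  rw [Measure.pi, toMeasure_apply _ _ hs]

end Product

/-- Lebesgue measure on complex matrices. -/
noncomputable def matrixVolume (m n : ℕ) : Measure (Matrix (Fin m) (Fin n) ℂ) :=
  (volume : Measure (Fin m → Fin n → ℂ))

instance : IsProbabilityMeasure complexGaussian := by
  unfold complexGaussian
  exact Measure.isProbabilityMeasure_map
    Complex.measurableEquivRealProd.symm.measurable.aemeasurable

instance (nr T : ℕ) : IsProbabilityMeasure (noise nr T) :=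
  inferInstanceAs (IsProbabilityMeasure (Measure.pi fun _ : Fin nr => Measure.pi fun _ : Fin T =>
    complexGaussian))

theorem complexGaussian_eq : complexGaussian =
    ((gaussianReal 0 (1 / 2)).prod (gaussianReal 0 (1 / 2))).map
      Complex.measurableEquivRealProd.symm := rfl

theorem volume_complex_eq : (volume : Measure ℂ) =
    ((volume : Measure ℝ).prod (volume : Measure ℝ)).map Complex.measurableEquivRealProd.symm :=
  (Complex.volume_preserving_equiv_real_prod.symm _).map_eq.symm

theorem exists_gaussianReal_le : ∃ c : ℝ≥0, gaussianReal 0 (1 / 2) ≤ c • (volume : Measure ℝ) := by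
  refine ⟨((√(2 * Real.pi * ((1 / 2 : ℝ≥0) : ℝ)))⁻¹).toNNReal, ?_⟩
  rw [gaussianReal_of_var_ne_zero _ (by norm_num)]
  have : (((√(2 * Real.pi * ((1 / 2 : ℝ≥0) : ℝ)))⁻¹).toNNReal • (volume : Measure ℝ)) =
      volume.withDensity fun _ => (((√(2 * Real.pi * ((1 / 2 : ℝ≥0) : ℝ)))⁻¹).toNNReal : ℝ≥0∞) := by
    rw [withDensity_const]; rfl
  rw [this]
  refine withDensity_mono (Eventually.of_forall fun x => ?_)
  rw [gaussianPDF]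
  refine ENNReal.ofReal_le_ofReal ?_
  rw [gaussianPDFReal]
  refine mul_le_of_le_one_right (by positivity) (Real.exp_le_one_iff.mpr ?_)
  rw [neg_div]
  exact neg_nonpos.mpr (by positivity)

/-- On a bounded interval the Gaussian density is at least its value `d` at the endpoint. -/
theorem exists_restrict_volume_le_gaussianReal (R : ℝ) : ∃ c : ℝ≥0,
    (volume : Measure ℝ).restrict (Set.Icc (-R) R) ≤ c • gaussianReal 0 (1 / 2) := by
  set d : ℝ := (√(2 * Real.pi * ((1 / 2 : ℝ≥0) : ℝ)))⁻¹ *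
    Real.exp (-R ^ 2 / (2 * ((1 / 2 : ℝ≥0) : ℝ))) with hd
  have hd0 : 0 < d := by positivity
  refine ⟨(d⁻¹).toNNReal, ?_⟩
  rw [gaussianReal_of_var_ne_zero _ (by norm_num), ← withDensity_indicator_one measurableSet_Icc]
  have : ((d⁻¹).toNNReal • (volume : Measure ℝ).withDensity (gaussianPDF 0 (1 / 2))) =
      volume.withDensity (((d⁻¹).toNNReal : ℝ≥0∞) • gaussianPDF 0 (1 / 2)) := by
    rw [withDensity_smul _ (measurable_gaussianPDF 0 (1 / 2))]; rfl
  rw [this]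
  refine withDensity_mono (Eventually.of_forall fun x => ?_)
  refine Set.indicator_le' (fun x hx => ?_) (fun _ _ => zero_le) x
  simp only [Pi.one_apply, Pi.smul_apply, smul_eq_mul, gaussianPDF]
  change 1 ≤ ENNReal.ofReal (d⁻¹) * _
  rw [← ENNReal.ofReal_mul (by positivity), ← ENNReal.ofReal_one]
  refine ENNReal.ofReal_le_ofReal ?_
  rw [← inv_mul_cancel₀ hd0.ne']
  refine mul_le_mul_of_nonneg_left ?_ (by positivity)
  rw [hd, gaussianPDFReal]
  refine mul_le_mul_of_nonneg_left (Real.exp_le_exp.mpr ?_) (by positivity)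
  have hx2 : (x - 0) ^ 2 ≤ R ^ 2 := by
    rw [sub_zero]; exact sq_le_sq' hx.1 hx.2
  gcongr

theorem exists_complexGaussian_le : ∃ c : ℝ≥0, complexGaussian ≤ c • (volume : Measure ℂ) := by
  obtain ⟨c, hc⟩ := exists_gaussianReal_le
  refine ⟨c * c, ?_⟩
  rw [complexGaussian_eq, volume_complex_eq, ← Measure.map_smul]
  refine Measure.map_mono ?_ (MeasurableEquiv.measurable _)
  refine (Measure.prod_mono hc hc).trans_eq ?_
  rw [Measure.prod_smul_left, Measure.prod_smul_right, smul_smul]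

theorem exists_restrict_volume_le_complexGaussian (R : ℝ) : ∃ c : ℝ≥0,
    (volume : Measure ℂ).restrict {z | z.re ∈ Set.Icc (-R) R ∧ z.im ∈ Set.Icc (-R) R} ≤
      c • complexGaussian := by
  obtain ⟨c, hc⟩ := exists_restrict_volume_le_gaussianReal R
  refine ⟨c * c, ?_⟩
  rw [complexGaussian_eq, volume_complex_eq, ← Measure.map_smul, MeasurableEquiv.restrict_map]
  refine Measure.map_mono ?_ (MeasurableEquiv.measurable _)
  have : Complex.measurableEquivRealProd.symm ⁻¹'
      {z | z.re ∈ Set.Icc (-R) R ∧ z.im ∈ Set.Icc (-R) R} = Set.Icc (-R) R ×ˢ Set.Icc (-R) R := rfl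
  rw [this, ← Measure.prod_restrict]
  refine (Measure.prod_mono hc hc).trans_eq ?_
  rw [Measure.prod_smul_left, Measure.prod_smul_right, smul_smul]

theorem exists_noise_le (nr T : ℕ) : ∃ c : ℝ≥0, noise nr T ≤ c • matrixVolume nr T := by
  obtain ⟨c, hc⟩ := exists_complexGaussian_le
  exact ⟨_, pi_le_smul_pi fun _ : Fin nr => pi_le_smul_pi fun _ : Fin T => hc⟩

theorem sq_norm_le_frobSq {m n : ℕ} (A : Matrix (Fin m) (Fin n) ℂ) (i : Fin m) (j : Fin n) :
    ‖A i j‖ ^ 2 ≤ frobSq A :=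
  (Finset.single_le_sum (f := fun j => ‖A i j‖ ^ 2) (fun _ _ => by positivity)
    (Finset.mem_univ j)).trans
    (Finset.single_le_sum (f := fun i => ∑ j, ‖A i j‖ ^ 2)
      (fun _ _ => Finset.sum_nonneg fun _ _ => by positivity) (Finset.mem_univ i))

theorem exists_matrixVolume_le_noise (nr T : ℕ) (K : ℝ) : ∃ c : ℝ≥0,
    ∀ S : Set (Matrix (Fin nr) (Fin T) ℂ), (∀ W ∈ S, frobSq W ≤ K) →
      matrixVolume nr T S ≤ c * noise nr T S := by
  obtain ⟨c, hc⟩ := exists_restrict_volume_le_complexGaussian (√K)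
  have h := pi_le_smul_pi fun _ : Fin nr => pi_le_smul_pi fun _ : Fin T => hc
  refine ⟨(c ^ Fintype.card (Fin T)) ^ Fintype.card (Fin nr), fun S hS => ?_⟩
  refine le_trans ?_ (h S)
  rw [← Measure.restrict_pi_pi, ← Measure.restrict_pi_pi]
  refine (Measure.restrict_eq_self (volume : Measure (Fin nr → Fin T → ℂ)) (s := S) ?_).ge
  intro W hW i _ j _
  have h1 := (sq_norm_le_frobSq W i j).trans (hS W hW)
  have h2 : ‖W i j‖ ≤ √K := Real.le_sqrt_of_sq_le h1
  exact ⟨abs_le.mp ((Complex.abs_re_le_norm _).trans h2),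
    abs_le.mp ((Complex.abs_im_le_norm _).trans h2)⟩

/-- Markov's inequality for the moment of order `2 p`. Polynomial decay of every order is all that
the exponent comparison needs. -/
theorem exists_gaussianReal_tail_le (p : ℕ) : ∃ C : ℝ, 0 ≤ C ∧ ∀ u : ℝ, 0 < u →
    gaussianReal 0 (1 / 2) {x | u ≤ x ^ 2} ≤ ENNReal.ofReal (C / u ^ p) := by
  set M := ∫⁻ x, ENNReal.ofReal ((x ^ 2) ^ p) ∂(gaussianReal 0 (1 / 2)) with hM
  have hMfin : M ≠ ∞ := by
    have h := (memLp_id_gaussianReal (μ := 0) (v := 1 / 2)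
      ((2 * p : ℕ) : ℝ≥0)).integrable_norm_rpow'
    have h2 : Integrable (fun x : ℝ => (x ^ 2) ^ p) (gaussianReal 0 (1 / 2)) := by
      refine h.congr (Eventually.of_forall fun x => ?_)
      simp only [id, ENNReal.coe_natCast, ENNReal.toReal_natCast, Real.rpow_natCast]
      simp [pow_mul]
    rw [hM, ← ofReal_integral_eq_lintegral_ofReal h2
      (Eventually.of_forall fun x => by positivity)]
    exact ENNReal.ofReal_ne_top
  refine ⟨M.toReal, ENNReal.toReal_nonneg, fun u hu => ?_⟩
  have h1 : {x : ℝ | u ≤ x ^ 2} ⊆ {x | ENNReal.ofReal (u ^ p) ≤ ENNReal.ofReal ((x ^ 2) ^ p)} :=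
    fun x hx => ENNReal.ofReal_le_ofReal (pow_le_pow_left₀ hu.le hx p)
  have h2 := meas_ge_le_lintegral_div (μ := gaussianReal 0 (1 / 2))
    (f := fun x : ℝ => ENNReal.ofReal ((x ^ 2) ^ p)) (by fun_prop)
    (ε := ENNReal.ofReal (u ^ p)) (by simp; positivity) ENNReal.ofReal_ne_top
  rw [ENNReal.ofReal_div_of_pos (by positivity), ENNReal.ofReal_toReal hMfin]
  exact (measure_mono h1).trans h2

theorem exists_complexGaussian_tail_le (p : ℕ) : ∃ C : ℝ, 0 ≤ C ∧ ∀ u : ℝ, 0 < u →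
    complexGaussian {z | u ≤ ‖z‖ ^ 2} ≤ ENNReal.ofReal (C / u ^ p) := by
  obtain ⟨C, hC, h⟩ := exists_gaussianReal_tail_le p
  refine ⟨2 * (C * 2 ^ p), by positivity, fun u hu => ?_⟩
  rw [complexGaussian_eq, MeasurableEquiv.map_apply]
  have hsub : Complex.measurableEquivRealProd.symm ⁻¹' {z | u ≤ ‖z‖ ^ 2} ⊆
      {x : ℝ | u / 2 ≤ x ^ 2} ×ˢ Set.univ ∪ Set.univ ×ˢ {x : ℝ | u / 2 ≤ x ^ 2} := by
    rintro ⟨x, y⟩ hxy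
    change u ≤ ‖(⟨x, y⟩ : ℂ)‖ ^ 2 at hxy
    rw [Complex.sq_norm, Complex.normSq_mk] at hxy
    by_cases hx : u / 2 ≤ x ^ 2
    · exact Or.inl ⟨hx, trivial⟩
    · refine Or.inr ⟨trivial, ?_⟩
      change u / 2 ≤ y ^ 2
      nlinarith
  refine (measure_mono hsub).trans ((measure_union_le _ _).trans ?_)
  rw [Measure.prod_prod, Measure.prod_prod, measure_univ, one_mul, mul_one]
  refine (add_le_add (h (u / 2) (by positivity)) (h (u / 2) (by positivity))).trans_eq ?_
  rw [← ENNReal.ofReal_add (by positivity) (by positivity)]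
  congr 1
  rw [div_pow]
  field_simp
  ring

theorem noise_eval_preimage {nr T : ℕ} (i : Fin nr) (j : Fin T) {s : Set ℂ}
    (hs : MeasurableSet s) : noise nr T {W | W i j ∈ s} = complexGaussian s := by
  have h1 := measurePreserving_eval
    (fun _ : Fin nr => Measure.pi fun _ : Fin T => complexGaussian) i
  have h2 := measurePreserving_eval (fun _ : Fin T => complexGaussian) j
  exact (h2.comp h1).measure_preimage hs.nullMeasurableSet

theorem exists_noise_tail_le (nr T p : ℕ) : ∃ C : ℝ, 0 ≤ C ∧ ∀ u : ℝ, 0 < u →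
    noise nr T {W | u ≤ frobSq W} ≤ ENNReal.ofReal (C / u ^ p) := by
  obtain ⟨C, hC, h⟩ := exists_complexGaussian_tail_le p
  -- Pigeonhole over the `nr * T` entries; the extra `1` keeps `N` positive and the comparison with
  -- `u` strict.
  set N : ℝ := nr * T + 1 with hN
  have hN0 : 0 < N := by positivity
  refine ⟨nr * T * (C * N ^ p), by positivity, fun u hu => ?_⟩
  have hsub : {W : Matrix (Fin nr) (Fin T) ℂ | u ≤ frobSq W} ⊆
      ⋃ i : Fin nr, ⋃ j : Fin T, {W | W i j ∈ {z : ℂ | u / N ≤ ‖z‖ ^ 2}} := by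
    intro W hW
    by_contra hcon
    simp only [Set.mem_iUnion, Set.mem_ofPred_eq, not_exists, not_le] at hcon
    have : frobSq W ≤ ∑ _i : Fin nr, ∑ _j : Fin T, u / N :=
      Finset.sum_le_sum fun i _ => Finset.sum_le_sum fun j _ => (hcon i j).le
    simp only [Finset.sum_const, Finset.card_univ, Fintype.card_fin, nsmul_eq_mul] at this
    have h3 : (nr : ℝ) * (T * (u / N)) < u := by
      rw [← mul_assoc, ← mul_div_assoc, div_lt_iff₀ hN0, mul_comm u]
      exact mul_lt_mul_of_pos_right (by rw [hN]; linarith) hu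
    exact absurd (hW.trans this) (not_le.mpr h3)
  have hm : MeasurableSet {z : ℂ | u / N ≤ ‖z‖ ^ 2} := measurableSet_le (by fun_prop) (by fun_prop)
  calc noise nr T {W | u ≤ frobSq W}
      ≤ ∑ i : Fin nr, ∑ j : Fin T, noise nr T {W | W i j ∈ {z : ℂ | u / N ≤ ‖z‖ ^ 2}} := by
        refine (measure_mono hsub).trans ((measure_iUnion_fintype_le _ _).trans ?_)
        exact Finset.sum_le_sum fun i _ => measure_iUnion_fintype_le _ _
    _ ≤ ∑ i : Fin nr, ∑ j : Fin T, ENNReal.ofReal (C / (u / N) ^ p) :=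
        Finset.sum_le_sum fun i _ => Finset.sum_le_sum fun j _ => by
          rw [noise_eval_preimage i j hm]
          exact h _ (by positivity)
    _ = _ := by
        simp only [Finset.sum_const, Finset.card_univ, Fintype.card_fin, nsmul_eq_mul]
        rw [← ENNReal.ofReal_natCast, ← ENNReal.ofReal_natCast (n := T),
          ← ENNReal.ofReal_mul (by positivity), ← ENNReal.ofReal_mul (by positivity)]
        congr 1
        rw [div_pow]
        field_simp

instance isAddHaarMeasure_volume_pi_pi (m n : ℕ) :
    (volume : Measure (Fin m → Fin n → ℂ)).IsAddHaarMeasure :=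
  Measure.pi.isAddHaarMeasure fun _ : Fin m => (volume : Measure (Fin n → ℂ))

theorem matrixVolume_preimage_add {m n : ℕ} (A : Matrix (Fin m) (Fin n) ℂ)
    (S : Set (Matrix (Fin m) (Fin n) ℂ)) :
    matrixVolume m n {W | A + W ∈ S} = matrixVolume m n S :=
  measure_preimage_add (volume : Measure (Fin m → Fin n → ℂ)) A S

theorem matrixVolume_frobSq_le_lt_top (m n : ℕ) (K : ℝ) :
    matrixVolume m n {W | frobSq W ≤ K} < ∞ := by
  have hsub : ({W | frobSq W ≤ K} : Set (Matrix (Fin m) (Fin n) ℂ)) ⊆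
      (Metric.closedBall (0 : Fin m → Fin n → ℂ) (√K) : Set (Fin m → Fin n → ℂ)) := by
    intro W hW
    exact mem_closedBall_zero_iff.mpr <| (pi_norm_le_iff_of_nonneg (Real.sqrt_nonneg _)).mpr
      fun i => (pi_norm_le_iff_of_nonneg (Real.sqrt_nonneg _)).mpr
      fun j => Real.le_sqrt_of_sq_le ((sq_norm_le_frobSq W i j).trans hW)
  exact (measure_mono (μ := (volume : Measure (Fin m → Fin n → ℂ))) hsub).trans_lt
    measure_closedBall_lt_top

theorem matrixVolume_frobSq_le_one_pos (m n : ℕ) : 0 < matrixVolume m n {W | frobSq W ≤ 1} := by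
  have ho : IsOpen {W : Fin m → Fin n → ℂ | ∑ i, ∑ j, ‖W i j‖ ^ 2 < 1} :=
    isOpen_lt (by fun_prop) continuous_const
  have h := ho.measure_pos (volume : Measure (Fin m → Fin n → ℂ)) ⟨0, by simp⟩
  refine h.trans_le (measure_mono fun W hW => ?_)
  exact le_of_lt (show ∑ i, ∑ j, ‖W i j‖ ^ 2 < 1 from hW)

/-- After transposition, left multiplication by `L` acts as `L` on each of the `n` columns
separately. -/
theorem det_mulLeftLinearMap {m n : ℕ} (L : Matrix (Fin m) (Fin m) ℂ) :
    LinearMap.det (mulLeftLinearMap (Fin n) ℂ L) = L.det ^ n := by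
  let e : Matrix (Fin m) (Fin n) ℂ ≃ₗ[ℂ] (Fin n → Fin m → ℂ) :=
    Matrix.transposeLinearEquiv (Fin m) (Fin n) ℂ ℂ
  have h : (e : _ →ₗ[ℂ] _) ∘ₗ mulLeftLinearMap (Fin n) ℂ L ∘ₗ (e.symm : _ →ₗ[ℂ] _) =
      LinearMap.pi fun i : Fin n => (Matrix.toLin' L) ∘ₗ LinearMap.proj i := by
    apply LinearMap.ext
    intro Z
    rfl
  rw [← LinearMap.det_conj _ e, h]
  have := LinearMap.det_pi (fun _ : Fin n => Matrix.toLin' L)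
  simp only [LinearMap.det_toLin', Finset.prod_const, Finset.card_univ, Fintype.card_fin] at this
  exact this

/-- The real Jacobian of a complex linear map is the squared modulus of its complex determinant. -/
theorem matrixVolume_image_mul {m n : ℕ} (L : Matrix (Fin m) (Fin m) ℂ)
    (S : Set (Matrix (Fin m) (Fin n) ℂ)) :
    matrixVolume m n ((fun Z => L * Z) '' S) =
      ENNReal.ofReal ((‖L.det‖ ^ 2) ^ n) * matrixVolume m n S := by
  let f₀ : (Fin m → Fin n → ℂ) →ₗ[ℂ] (Fin m → Fin n → ℂ) := mulLeftLinearMap (Fin n) ℂ L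
  let f : (Fin m → Fin n → ℂ) →ₗ[ℝ] (Fin m → Fin n → ℂ) := f₀.restrictScalars ℝ
  have h := Measure.addHaar_image_linearMap (volume : Measure (Fin m → Fin n → ℂ)) f S
  have hdet : LinearMap.det f = (‖L.det‖ ^ 2) ^ n := by
    have h1 : LinearMap.det f = Algebra.norm ℝ (LinearMap.det (mulLeftLinearMap (Fin n) ℂ L)) :=
      LinearMap.det_restrictScalars
    rw [h1, det_mulLeftLinearMap, Algebra.norm_complex_apply, map_pow, Complex.sq_norm]
  rw [hdet, abs_of_nonneg (by positivity)] at h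
  exact h

/-! ### Measurability, maximum likelihood decoding and conditional error probability. -/

section Measurability

variable {α : Type*} [MeasurableSpace α]

theorem measurable_matrix_iff {m n : ℕ} {f : α → Matrix (Fin m) (Fin n) ℂ} :
    Measurable f ↔ ∀ i j, Measurable fun x => f x i j := by
  constructor
  · intro h i j
    exact (measurable_pi_apply j).comp ((measurable_pi_apply i).comp h)
  · intro h
    exact measurable_pi_lambda _ fun i => measurable_pi_lambda _ fun j => h i j

theorem measurable_matrix_mul {m n l : ℕ} {f : α → Matrix (Fin m) (Fin n) ℂ}
    {g : α → Matrix (Fin n) (Fin l) ℂ} (hf : Measurable f) (hg : Measurable g) :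
    Measurable fun x => f x * g x := by
  rw [measurable_matrix_iff] at hf hg ⊢
  intro i j
  simp only [Matrix.mul_apply]
  exact Finset.measurable_fun_sum _ fun k _ => (hf i k).mul (hg k j)

theorem measurable_matrix_add {m n : ℕ} {f g : α → Matrix (Fin m) (Fin n) ℂ}
    (hf : Measurable f) (hg : Measurable g) : Measurable fun x => f x + g x := by
  rw [measurable_matrix_iff] at hf hg ⊢
  exact fun i j => (hf i j).add (hg i j)

theorem measurable_matrix_sub {m n : ℕ} {f g : α → Matrix (Fin m) (Fin n) ℂ}
    (hf : Measurable f) (hg : Measurable g) : Measurable fun x => f x - g x := by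
  rw [measurable_matrix_iff] at hf hg ⊢
  exact fun i j => (hf i j).sub (hg i j)

theorem measurable_frobSq {m n : ℕ} {f : α → Matrix (Fin m) (Fin n) ℂ} (hf : Measurable f) :
    Measurable fun x => frobSq (f x) := by
  rw [measurable_matrix_iff] at hf
  exact Finset.measurable_fun_sum _ fun i _ => Finset.measurable_fun_sum _ fun j _ =>
    (hf i j).norm.pow_const 2

theorem measurable_det {n : ℕ} {f : α → Matrix (Fin n) (Fin n) ℂ} (hf : Measurable f) :
    Measurable fun x => (f x).det := by
  rw [measurable_matrix_iff] at hf
  simp only [Matrix.det_apply]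
  exact Finset.measurable_fun_sum _ fun σ _ =>
    (Finset.measurable_fun_prod _ fun i _ => hf _ _).const_smul _

theorem measurableSet_outage {nr nt : ℕ} (r snr : ℝ) :
    MeasurableSet {H : Matrix (Fin nr) (Fin nt) ℂ |
      Real.logb 2 ((1 + (snr : ℂ) • (H * Hᴴ)).det.re) < r * Real.logb 2 snr} := by
  refine measurableSet_lt ?_ measurable_const
  have h1 : Measurable fun H : Matrix (Fin nr) (Fin nt) ℂ => (1 + (snr : ℂ) • (H * Hᴴ)).det := by
    refine measurable_det ?_
    have h2 : Measurable fun H : Matrix (Fin nr) (Fin nt) ℂ => H * Hᴴ := by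
      refine measurable_matrix_mul measurable_id (measurable_matrix_iff.mpr fun i j => ?_)
      have := measurable_matrix_iff.mp (measurable_id (α := Matrix (Fin nr) (Fin nt) ℂ)) j i
      simp only [Matrix.conjTranspose_apply]
      exact continuous_star.measurable.comp this
    rw [measurable_matrix_iff] at h2 ⊢
    intro i j
    simp only [Matrix.add_apply, Matrix.smul_apply]
    exact ((h2 i j).const_smul (snr : ℂ)).const_add _
  exact (Real.measurable_log.comp (Complex.measurable_re.comp h1)).div_const _

end Measurability

namespace Code

variable {nt T nr : ℕ}

theorem mlDecode_eq_iff (C : Code nt T) (H : Matrix (Fin nr) (Fin nt) ℂ)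
    (Y : Matrix (Fin nr) (Fin T) ℂ) (m : Fin C.size) :
    C.mlDecode H Y = m ↔ (∀ m', frobSq (Y - H * C.word m) ≤ frobSq (Y - H * C.word m')) ∧
      ∀ l, (∀ m', frobSq (Y - H * C.word l) ≤ frobSq (Y - H * C.word m')) → m ≤ l := by
  rw [mlDecode, Finset.min'_eq_iff]
  simp

theorem frobSq_sub_mlDecode_le (C : Code nt T) (H : Matrix (Fin nr) (Fin nt) ℂ)
    (Y : Matrix (Fin nr) (Fin T) ℂ) (m : Fin C.size) :
    frobSq (Y - H * C.word (C.mlDecode H Y)) ≤ frobSq (Y - H * C.word m) :=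
  ((C.mlDecode_eq_iff H Y _).mp rfl).1 m

theorem measurableSet_mlDecode_eq (C : Code nt T) {α : Type*} [MeasurableSpace α]
    {f : α → Matrix (Fin nr) (Fin nt) ℂ} {g : α → Matrix (Fin nr) (Fin T) ℂ}
    (hf : Measurable f) (hg : Measurable g) (m : Fin C.size) :
    MeasurableSet {x | C.mlDecode (f x) (g x) = m} := by
  simp only [mlDecode_eq_iff]
  have hd : ∀ l, Measurable fun x => frobSq (g x - f x * C.word l) := fun l =>
    measurable_frobSq (measurable_matrix_sub hg (measurable_matrix_mul hf measurable_const))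
  have ha : ∀ l, MeasurableSet {x | ∀ m', frobSq (g x - f x * C.word l) ≤
      frobSq (g x - f x * C.word m')} := fun l => by
    rw [Set.ofPred_forall]
    exact MeasurableSet.iInter fun m' => measurableSet_le (hd l) (hd m')
  refine (ha m).inter ?_
  change MeasurableSet {x | _}
  rw [Set.ofPred_forall]
  refine MeasurableSet.iInter fun l => ?_
  by_cases h : m ≤ l
  · simp [h]
  · simp only [h, imp_false]
    exact (ha l).compl

/-- The error probability for a fixed channel matrix. -/
noncomputable def condErrorProb (C : Code nt T) (H : Matrix (Fin nr) (Fin nt) ℂ) : ℝ≥0∞ :=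
  (∑ m, noise nr T {W | C.mlDecode H (H * C.word m + W) ≠ m}) / C.size

theorem measurableSet_mlDecode_ne (C : Code nt T) (m : Fin C.size) :
    MeasurableSet {p : Matrix (Fin nr) (Fin nt) ℂ × Matrix (Fin nr) (Fin T) ℂ |
      C.mlDecode p.1 (p.1 * C.word m + p.2) ≠ m} :=
  (C.measurableSet_mlDecode_eq measurable_fst
    (measurable_matrix_add (measurable_matrix_mul measurable_fst measurable_const)
      measurable_snd) m).compl

theorem measurableSet_mlDecode_noise_eq (C : Code nt T) (H : Matrix (Fin nr) (Fin nt) ℂ)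
    (m : Fin C.size) : MeasurableSet {W : Matrix (Fin nr) (Fin T) ℂ |
      C.mlDecode H (H * C.word m + W) = m} :=
  C.measurableSet_mlDecode_eq measurable_const
    (measurable_matrix_add measurable_const measurable_id) m

theorem errorProb_eq_lintegral (C : Code nt T) (μ : Measure (Matrix (Fin nr) (Fin nt) ℂ))
    [IsProbabilityMeasure μ] : C.errorProb μ = ∫⁻ H, C.condErrorProb H ∂μ := by
  have hm : ∀ m, Measurable fun H : Matrix (Fin nr) (Fin nt) ℂ =>
      noise nr T {W | C.mlDecode H (H * C.word m + W) ≠ m} := fun m =>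
    measurable_measure_prodMk_left (C.measurableSet_mlDecode_ne m)
  simp only [errorProb, condErrorProb, div_eq_mul_inv]
  rw [lintegral_mul_const _ (Finset.measurable_fun_sum _ fun m _ => hm m),
    lintegral_finsetSum _ fun m _ => hm m]
  congr 1
  refine Finset.sum_congr rfl fun m _ => ?_
  exact Measure.prod_apply (C.measurableSet_mlDecode_ne m)

theorem measurable_condErrorProb (C : Code nt T) :
    Measurable fun H : Matrix (Fin nr) (Fin nt) ℂ => C.condErrorProb H := by
  refine Measurable.div_const (Finset.measurable_fun_sum _ fun m _ => ?_) _
  exact measurable_measure_prodMk_left (C.measurableSet_mlDecode_ne m)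

theorem mul_measure_le_errorProb (C : Code nt T) (μ : Measure (Matrix (Fin nr) (Fin nt) ℂ))
    [IsProbabilityMeasure μ] {c : ℝ≥0∞} {S : Set (Matrix (Fin nr) (Fin nt) ℂ)}
    (hS : ∀ H ∈ S, c ≤ C.condErrorProb H) : c * μ S ≤ C.errorProb μ := by
  rw [errorProb_eq_lintegral]
  refine le_trans ?_ (mul_meas_ge_le_lintegral C.measurable_condErrorProb c)
  gcongr
  exact hS

end Code

/-! ### Error bounds for a single code. -/

namespace Code

variable {nt T nr : ℕ}

/-- Outside a set of channels, errors require noise of norm at least half the minimum distance. -/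
theorem errorProb_le (C : Code nt T) (μ : Measure (Matrix (Fin nr) (Fin nt) ℂ))
    [IsProbabilityMeasure μ] (S : Set (Matrix (Fin nr) (Fin nt) ℂ)) (δ : ℝ)
    (h : ∀ H ∉ S, ∀ a b, a ≠ b → 4 * δ ≤ frobSq (H * (C.word a - C.word b))) :
    C.errorProb μ ≤ μ S + noise nr T {W | δ ≤ frobSq W} := by
  have hm : ∀ m, (μ.prod (noise nr T)) {p | C.mlDecode p.1 (p.1 * C.word m + p.2) ≠ m} ≤
      μ S + noise nr T {W | δ ≤ frobSq W} := by
    intro m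
    have hsub : {p : Matrix (Fin nr) (Fin nt) ℂ × Matrix (Fin nr) (Fin T) ℂ |
        C.mlDecode p.1 (p.1 * C.word m + p.2) ≠ m} ⊆
        S ×ˢ Set.univ ∪ Set.univ ×ˢ {W | δ ≤ frobSq W} := by
      rintro ⟨H, W⟩ hp
      by_cases hH : H ∈ S
      · exact Or.inl ⟨hH, trivial⟩
      refine Or.inr ⟨trivial, ?_⟩
      set m' := C.mlDecode H (H * C.word m + W) with hm'
      -- A decision for `m'` means that `W` plus the received difference is no longer than `W`, so
      -- the squared difference is at most `4 ‖W‖²`. One noise event serves all competitors at once: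
      -- there is no union bound and the code size does not enter.
      have h1 := C.frobSq_sub_mlDecode_le H (H * C.word m + W) m
      rw [← hm', add_sub_cancel_left] at h1
      have h2 := h H hH m m' (Ne.symm hp)
      have h3 := frobSq_sub_le (H * C.word m + W - H * C.word m') W
      have e : H * C.word m + W - H * C.word m' - W = H * (C.word m - C.word m') := by
        rw [Matrix.mul_sub]; abel
      rw [e] at h3
      change δ ≤ frobSq W
      linarith
    refine (measure_mono hsub).trans ((measure_union_le _ _).trans ?_)
    rw [Measure.prod_prod, Measure.prod_prod, measure_univ, measure_univ, one_mul, mul_one]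
  have hs : (C.size : ℝ≥0∞) ≠ 0 := by exact_mod_cast C.size_pos.ne'
  rw [errorProb, ENNReal.div_le_iff hs (ENNReal.natCast_ne_top _), mul_comm]
  refine (Finset.sum_le_sum fun m _ => hm m).trans_eq ?_
  simp [mul_add]

/-- If two codewords are received at bounded distance, one of them is often decoded wrongly. -/
theorem exists_le_condErrorProb_of_frobSq_le (nr nt T : ℕ) {K : ℝ} (hK : 0 ≤ K) :
    ∃ c : ℝ, 0 < c ∧ ∀ (C : Code nt T) (H : Matrix (Fin nr) (Fin nt) ℂ) (a b : Fin C.size),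
      a ≠ b → frobSq (H * (C.word a - C.word b)) ≤ K →
      ENNReal.ofReal (c / C.size) ≤ C.condErrorProb H := by
  -- `2 + 2 * K` bounds the squared norm on the unit ball shifted by a matrix of squared norm at
  -- most `K`.
  obtain ⟨k, hk⟩ := exists_matrixVolume_le_noise nr T (2 + 2 * K)
  set v := matrixVolume nr T {W | frobSq W ≤ 1} with hv
  have hv0 : 0 < v := matrixVolume_frobSq_le_one_pos nr T
  have hvt : v ≠ ∞ := (matrixVolume_frobSq_le_lt_top nr T 1).ne
  have hvr : 0 < v.toReal := ENNReal.toReal_pos hv0.ne' hvt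
  refine ⟨v.toReal / (k + 1), by positivity, fun C H a b hab hd => ?_⟩
  set A := {W : Matrix (Fin nr) (Fin T) ℂ | C.mlDecode H (H * C.word a + W) ≠ a} with hA
  set B := {W : Matrix (Fin nr) (Fin T) ℂ | C.mlDecode H (H * C.word b + W) ≠ b} with hB
  -- If noise `W` leaves `a` correctly decoded, then noise `Δ + W` after sending `b` produces the
  -- same output and is an error. So `A` and a translate of `B` cover the unit ball.
  have h1 : v ≤ k * noise nr T A + k * noise nr T B := by
    have hsub : ({W | frobSq W ≤ 1} : Set (Matrix (Fin nr) (Fin T) ℂ)) ⊆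
        (A ∩ {W | frobSq W ≤ 1}) ∪ (Aᶜ ∩ {W | frobSq W ≤ 1}) := by
      intro W hW
      by_cases h : W ∈ A
      · exact Or.inl ⟨h, hW⟩
      · exact Or.inr ⟨h, hW⟩
    refine (measure_mono hsub).trans ((measure_union_le _ _).trans (add_le_add ?_ ?_))
    · refine (hk _ fun W hW => ?_).trans ?_
      · have : frobSq W ≤ 1 := hW.2
        linarith
      · gcongr
        exact Set.inter_subset_left
    · set Δ := H * (C.word a - C.word b) with hΔ
      have hsub2 : Aᶜ ∩ {W : Matrix (Fin nr) (Fin T) ℂ | frobSq W ≤ 1} ⊆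
          {W | Δ + W ∈ B ∩ {W | frobSq W ≤ 2 + 2 * K}} := by
        rintro W ⟨hWA, hW⟩
        have hWA' : C.mlDecode H (H * C.word a + W) = a := not_not.mp hWA
        refine ⟨?_, ?_⟩
        · change C.mlDecode H (H * C.word b + (Δ + W)) ≠ b
          have : H * C.word b + (Δ + W) = H * C.word a + W := by
            rw [hΔ, Matrix.mul_sub]; abel
          rw [this, hWA']
          exact hab
        · have h3 := frobSq_sub_le W (-Δ)
          rw [frobSq_neg, sub_neg_eq_add, add_comm W] at h3
          have hW1 : frobSq W ≤ 1 := hW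
          change frobSq (Δ + W) ≤ _
          linarith
      refine (measure_mono hsub2).trans ?_
      rw [matrixVolume_preimage_add]
      refine (hk _ fun W hW => hW.2).trans ?_
      gcongr
      exact Set.inter_subset_left
  have h2 : noise nr T A + noise nr T B ≤
      ∑ m, noise nr T {W | C.mlDecode H (H * C.word m + W) ≠ m} := by
    rw [← Finset.sum_pair (f := fun m => noise nr T {W | C.mlDecode H (H * C.word m + W) ≠ m}) hab]
    exact Finset.sum_le_sum_of_subset (Finset.subset_univ _)
  have hs : (0 : ℝ) < C.size := by exact_mod_cast C.size_pos
  rw [condErrorProb, ENNReal.ofReal_div_of_pos hs, ENNReal.ofReal_natCast]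
  gcongr
  refine le_trans ?_ h2
  rw [ENNReal.ofReal_div_of_pos (by positivity), ENNReal.ofReal_toReal hvt]
  refine ENNReal.div_le_of_le_mul ?_
  rw [← mul_add] at h1
  refine h1.trans ?_
  rw [mul_comm]
  gcongr
  rw [ENNReal.ofReal_add k.coe_nonneg zero_le_one, ENNReal.ofReal_coe_nnreal]
  exact le_self_add

theorem exists_noise_lt_frobSq_le (nr T : ℕ) :
    ∃ u : ℝ, 0 < u ∧ noise nr T {W | u ≤ frobSq W} ≤ 1 / 4 := by
  obtain ⟨c, hc, h⟩ := exists_noise_tail_le nr T 1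
  refine ⟨4 * c + 1, by positivity, (h _ (by positivity)).trans ?_⟩
  have : (1 / 4 : ℝ≥0∞) = ENNReal.ofReal (1 / 4) := by
    rw [ENNReal.ofReal_div_of_pos (by norm_num)]; norm_num
  rw [this]
  refine ENNReal.ofReal_le_ofReal ?_
  rw [pow_one, div_le_div_iff₀ (by positivity) (by norm_num)]
  linarith

/-- Strong form of the converse of the channel coding theorem: a code that is too large for the
channel is decoded wrongly at least half of the time. -/
theorem exists_half_le_condErrorProb (nr nt T : ℕ) {a : ℝ} :
    ∃ B : ℝ, 0 ≤ B ∧ ∀ (C : Code nt T) (H : Matrix (Fin nr) (Fin nt) ℂ) (s : ℝ), 0 < s →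
      (∀ m, frobSq (C.word m) ≤ a * s) →
      B * (1 + (s : ℂ) • (H * Hᴴ)).det.re ^ T ≤ C.size → 1 / 2 ≤ C.condErrorProb H := by
  obtain ⟨u, hu, hu4⟩ := exists_noise_lt_frobSq_le nr T
  obtain ⟨c, hc⟩ := exists_noise_le nr T
  set v := matrixVolume nr T {W | frobSq W ≤ a + u} with hv
  have hvt : v ≠ ∞ := (matrixVolume_frobSq_le_lt_top nr T (a + u)).ne
  -- The `4` makes the volume term at most a quarter of the code size; noise longer than `u` costs
  -- another quarter, so at most half of the transmissions are decoded correctly.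
  refine ⟨4 * (c * v.toReal), by positivity, fun C H s hs hpow hB => ?_⟩
  obtain ⟨L, hL, hLdet, hLu⟩ := exists_mul_conjTranspose_eq H hs.le
  set E : Fin C.size → Set (Matrix (Fin nr) (Fin T) ℂ) := fun m =>
    {Y | C.mlDecode H Y = m} ∩ {Y | frobSq (Y - H * C.word m) ≤ u} with hE
  have hEm : ∀ m, MeasurableSet (E m) := fun m =>
    (C.measurableSet_mlDecode_eq measurable_const measurable_id m).inter
      (measurableSet_le (measurable_frobSq (measurable_matrix_sub measurable_id measurable_const))
        measurable_const)
  have hEd : Pairwise (Function.onFun Disjoint E) := by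
    intro m m' hmm
    refine Set.disjoint_left.mpr fun Y hY hY' => hmm ?_
    exact hY.1.symm.trans hY'.1
  -- Packing: the truncated decoding regions are disjoint and, by `frobSq_preimage_le`, all lie in
  -- the image under `L` of one ball.
  have hsum : ∑ m, matrixVolume nr T (E m) ≤ ENNReal.ofReal (‖L.det‖ ^ 2) ^ T * v := by
    rw [← tsum_fintype (L := .unconditional _), ← measure_iUnion hEd hEm,
      ← ENNReal.ofReal_pow (by positivity), hv, ← matrixVolume_image_mul]
    refine measure_mono (Set.iUnion_subset fun m Y hY => ?_)
    refine ⟨L⁻¹ * Y, ?_, ?_⟩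
    · have hLY : L * (L⁻¹ * Y) = H * C.word m + (Y - H * C.word m) := by
        rw [← Matrix.mul_assoc, Matrix.mul_nonsing_inv _ hLu, Matrix.one_mul]; abel
      have h1 := frobSq_preimage_le hs H L hL hLu _ _ _ hLY
      have h2 : frobSq (Y - H * C.word m) ≤ u := hY.2
      have h3 : frobSq (C.word m) / s ≤ a := (div_le_iff₀ hs).mpr (hpow m)
      change frobSq _ ≤ a + u
      linarith
    · change L * (L⁻¹ * Y) = Y
      rw [← Matrix.mul_assoc, Matrix.mul_nonsing_inv _ hLu, Matrix.one_mul]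
  have hcorr : ∀ m, noise nr T {W | C.mlDecode H (H * C.word m + W) = m} ≤
      c * matrixVolume nr T (E m) + 1 / 4 := by
    intro m
    have hsub : {W : Matrix (Fin nr) (Fin T) ℂ | C.mlDecode H (H * C.word m + W) = m} ⊆
        {W | H * C.word m + W ∈ E m} ∪ {W | u ≤ frobSq W} := by
      intro W hW
      by_cases h : u ≤ frobSq W
      · exact Or.inr h
      · refine Or.inl ⟨hW, ?_⟩
        change frobSq _ ≤ u
        rw [add_sub_cancel_left]
        exact (not_le.mp h).le
    refine (measure_mono hsub).trans ((measure_union_le _ _).trans (add_le_add ?_ hu4))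
    refine (hc _).trans_eq ?_
    rw [Measure.smul_apply, matrixVolume_preimage_add]
    rfl
  have hs0 : (C.size : ℝ≥0∞) ≠ 0 := by exact_mod_cast C.size_pos.ne'
  have htot : ∑ m, noise nr T {W | C.mlDecode H (H * C.word m + W) = m} ≤ C.size / 2 := by
    calc ∑ m, noise nr T {W | C.mlDecode H (H * C.word m + W) = m}
        ≤ ∑ m, (c * matrixVolume nr T (E m) + 1 / 4) := Finset.sum_le_sum fun m _ => hcorr m
      _ ≤ c * (ENNReal.ofReal (‖L.det‖ ^ 2) ^ T * v) + C.size / 4 := by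
          rw [Finset.sum_add_distrib, ← Finset.mul_sum]
          gcongr
          simp [div_eq_mul_inv]
      _ ≤ C.size / 4 + C.size / 4 := by
          gcongr
          rw [ENNReal.le_div_iff_mul_le (by norm_num) (by norm_num), ← ENNReal.ofReal_toReal hvt,
            ← ENNReal.ofReal_coe_nnreal, ← ENNReal.ofReal_pow (by positivity),
            ← ENNReal.ofReal_mul (by positivity), ← ENNReal.ofReal_mul (by positivity),
            ← ENNReal.ofReal_natCast, show (4 : ℝ≥0∞) = ENNReal.ofReal 4 by simp,
            ← ENNReal.ofReal_mul (by positivity)]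
          refine ENNReal.ofReal_le_ofReal ?_
          rw [hLdet]
          linarith
      _ = C.size / 2 := by
          rw [← ENNReal.add_div, ← mul_two, ENNReal.div_eq_div_iff (by norm_num) (by norm_num)
            (by norm_num) (by norm_num)]
          ring
  have hcompl : ∀ m, noise nr T {W | C.mlDecode H (H * C.word m + W) ≠ m} +
      noise nr T {W | C.mlDecode H (H * C.word m + W) = m} = 1 := by
    intro m
    have := measure_add_measure_compl (μ := noise nr T) (C.measurableSet_mlDecode_noise_eq H m)
    rw [measure_univ] at this
    rw [add_comm]
    exact this
  have hall : ∑ m, noise nr T {W | C.mlDecode H (H * C.word m + W) ≠ m} +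
      ∑ m, noise nr T {W | C.mlDecode H (H * C.word m + W) = m} = C.size := by
    rw [← Finset.sum_add_distrib, Finset.sum_congr rfl fun m _ => hcompl m]
    simp
  have hhalf : (C.size : ℝ≥0∞) / 2 ≤
      ∑ m, noise nr T {W | C.mlDecode H (H * C.word m + W) ≠ m} := by
    have h1 : (C.size : ℝ≥0∞) / 2 + C.size / 2 ≤
      ∑ m, noise nr T {W | C.mlDecode H (H * C.word m + W) ≠ m} + C.size / 2 := by
      rw [ENNReal.add_halves]
      nth_rw 1 [← hall]
      gcongr
    exact (ENNReal.add_le_add_iff_right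
      (ENNReal.div_ne_top (ENNReal.natCast_ne_top _) (by norm_num))).mp h1
  rw [condErrorProb, ENNReal.le_div_iff_mul_le (Or.inl hs0) (Or.inl (ENNReal.natCast_ne_top _))]
  refine le_trans (le_of_eq ?_) hhalf
  rw [one_div, mul_comm, div_eq_mul_inv]

end Code

/-! ### Decay exponents and powers of the signal-to-noise ratio. -/

/-- The case `p = 0` needs no separate treatment: `ENNReal.log 0 = ⊥` makes the exponent `⊤`. -/
theorem coe_lt_decayExponent_iff {p : ℝ≥0∞} {s : ℝ} (hs : 1 < s) (c : ℝ) :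
    (c : EReal) < decayExponent p s ↔ p < ENNReal.ofReal (s ^ (-c)) := by
  have hL : 0 < Real.log s := Real.log_pos hs
  have hs0 : 0 < s := by linarith
  rw [decayExponent, EReal.lt_div_iff (by exact_mod_cast hL) (EReal.coe_ne_top _),
    EReal.lt_neg_comm, ← ENNReal.log_lt_log_iff (x := p),
    ENNReal.log_ofReal_of_pos (Real.rpow_pos_of_pos hs0 _), Real.log_rpow hs0, neg_mul,
    EReal.coe_neg, EReal.coe_mul]

theorem decayExponent_lt_coe_iff {p : ℝ≥0∞} {s : ℝ} (hs : 1 < s) (c : ℝ) :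
    decayExponent p s < c ↔ ENNReal.ofReal (s ^ (-c)) < p := by
  have hL : 0 < Real.log s := Real.log_pos hs
  have hs0 : 0 < s := by linarith
  rw [decayExponent, EReal.div_lt_iff (by exact_mod_cast hL) (EReal.coe_ne_top _),
    EReal.neg_lt_comm, ← ENNReal.log_lt_log_iff (y := p),
    ENNReal.log_ofReal_of_pos (Real.rpow_pos_of_pos hs0 _), Real.log_rpow hs0, neg_mul,
    EReal.coe_neg, EReal.coe_mul]

theorem eventually_mul_rpow_lt_rpow {α β : ℝ} (h : α < β) (B : ℝ) :
    ∀ᶠ s : ℝ in atTop, B * s ^ α < s ^ β := by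
  filter_upwards [(tendsto_rpow_atTop (sub_pos.mpr h)).eventually_gt_atTop B,
    eventually_gt_atTop 0] with s hs hs0
  calc B * s ^ α < s ^ (β - α) * s ^ α :=
        mul_lt_mul_of_pos_right hs (Real.rpow_pos_of_pos hs0 _)
    _ = s ^ β := by rw [← Real.rpow_add hs0, sub_add_cancel]

theorem logb_det_lt_iff {nr nt : ℕ} {s : ℝ} (hs : 1 < s) (ρ : ℝ)
    (H : Matrix (Fin nr) (Fin nt) ℂ) :
    Real.logb 2 ((1 + (s : ℂ) • (H * Hᴴ)).det.re) < ρ * Real.logb 2 s ↔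
      (1 + (s : ℂ) • (H * Hᴴ)).det.re < s ^ ρ := by
  have hs0 : 0 < s := by linarith
  have h1 : 0 < (1 + (s : ℂ) • (H * Hᴴ)).det.re :=
    zero_lt_one.trans_le (one_le_det_one_add H hs0.le)
  rw [← Real.logb_rpow_eq_mul_logb_of_pos hs0,
    Real.logb_lt_logb_iff one_lt_two h1 (Real.rpow_pos_of_pos hs0 _)]

theorem two_rpow_eq {s : ℝ} (hs : 1 < s) (x : ℝ) : (2 : ℝ) ^ x = s ^ (x / Real.logb 2 s) := by
  have hs0 : 0 < s := by linarith
  have hl : Real.logb 2 s ≠ 0 := (Real.logb_pos one_lt_two hs).ne'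
  nth_rw 1 [← Real.rpow_logb two_pos (by norm_num : (2 : ℝ) ≠ 1) hs0]
  rw [← Real.rpow_mul two_pos.le, mul_div_cancel₀ _ hl]

theorem Code.size_eq_rpow_rate {nt T : ℕ} (hT : 0 < T) (C : Code nt T) :
    (C.size : ℝ) = ((2 : ℝ) ^ C.rate) ^ T := by
  have hs : (0 : ℝ) < C.size := by exact_mod_cast C.size_pos
  have hT' : (T : ℝ) ≠ 0 := by exact_mod_cast hT.ne'
  rw [← Real.rpow_natCast, ← Real.rpow_mul two_pos.le, Code.rate, div_mul_cancel₀ _ hT',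
    Real.rpow_logb two_pos (by norm_num) hs]

/-! ### Outage bound for all codes and sufficiency of the product criterion. -/

section Sequence

variable {nt nr T : ℕ} {r : ℝ} {snr : ℕ → ℝ} {C : ℕ → Code nt T}

theorem eventually_rpow_le_two_rpow_rate (hsnr : Tendsto snr atTop atTop)
    (hrate : Tendsto (fun k => (C k).rate / Real.logb 2 (snr k)) atTop (𝓝 r)) {ρ : ℝ}
    (hρ : ρ < r) : ∀ᶠ k in atTop, snr k ^ ρ ≤ 2 ^ (C k).rate := by
  filter_upwards [hsnr.eventually_gt_atTop 1, hrate.eventually_const_lt hρ] with k h1 h2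
  rw [two_rpow_eq h1]
  exact Real.rpow_le_rpow_of_exponent_le h1.le h2.le

theorem eventually_two_rpow_rate_le (hsnr : Tendsto snr atTop atTop)
    (hrate : Tendsto (fun k => (C k).rate / Real.logb 2 (snr k)) atTop (𝓝 r)) {ρ : ℝ}
    (hρ : r < ρ) : ∀ᶠ k in atTop, 2 ^ (C k).rate ≤ snr k ^ ρ := by
  filter_upwards [hsnr.eventually_gt_atTop 1, hrate.eventually_lt_const hρ] with k h1 h2
  rw [two_rpow_eq h1]
  exact Real.rpow_le_rpow_of_exponent_le h1.le h2.le

/-- No sequence of codes beats the outage curve. -/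
theorem eventually_decayExponent_errorProb_lt (hT : 0 < T) (hsnr : Tendsto snr atTop atTop)
    (hpower : ∀ k, (C k).PowerConstraint (snr k))
    (hrate : Tendsto (fun k => (C k).rate / Real.logb 2 (snr k)) atTop (𝓝 r))
    (μ : Measure (Matrix (Fin nr) (Fin nt) ℂ)) [IsProbabilityMeasure μ] {dout : ℝ → EReal}
    (hout : ∀ᶠ ρ in 𝓝 r, HasOutageExponent μ ρ (dout ρ)) (hcont : ContinuousAt dout r)
    {c : ℝ} (hc : dout r < c) :
    ∀ᶠ k in atTop, decayExponent ((C k).errorProb μ) (snr k) < c := by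
  obtain ⟨c', hdc', hc'c⟩ := EReal.lt_iff_exists_real_btwn.mp hc
  have hc'c : c' < c := by exact_mod_cast hc'c
  obtain ⟨ρ, ⟨hρout, hρd⟩, hρr⟩ :=
    (((hout.and (hcont.eventually_lt_const hdc')).filter_mono nhdsWithin_le_nhds).and
      (self_mem_nhdsWithin (s := Set.Iio r))).exists
  have hρr : ρ < r := hρr
  obtain ⟨B, hB0, hB⟩ := Code.exists_half_le_condErrorProb nr nt T (a := T * nt)
  -- The gap from `ρ` to `ρ'` absorbs the constant `B`; the gap from `ρ'` to `r` absorbs the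
  -- fluctuation of the rate.
  set ρ' := (ρ + r) / 2 with hρ'
  have hT' : (0 : ℝ) < T := by exact_mod_cast hT
  have hTρ : ρ * T < ρ' * T := mul_lt_mul_of_pos_right (by rw [hρ']; linarith) hT'
  filter_upwards [hsnr.eventually_gt_atTop 1,
    hsnr.eventually (hρout.eventually_lt_const hρd),
    eventually_rpow_le_two_rpow_rate hsnr hrate (ρ := ρ') (by rw [hρ']; linarith),
    hsnr.eventually (eventually_mul_rpow_lt_rpow hTρ B),
    hsnr.eventually (eventually_mul_rpow_lt_rpow (neg_lt_neg hc'c) 2)] with k h1 h2 h3 h4 h5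
  have h0 : 0 < snr k := by linarith
  rw [decayExponent_lt_coe_iff h1] at h2 ⊢
  have h6 : 1 / 2 * outageProb μ ρ (snr k) ≤ (C k).errorProb μ := by
    refine (C k).mul_measure_le_errorProb μ fun H hH => ?_
    have hH' := (logb_det_lt_iff h1 ρ H).mp hH
    refine hB (C k) H (snr k) h0 (hpower k) ?_
    calc B * (1 + (snr k : ℂ) • (H * Hᴴ)).det.re ^ T ≤ B * (snr k ^ ρ) ^ T := by
          have := one_le_det_one_add H h0.le
          gcongr
      _ = B * snr k ^ (ρ * T) := by rw [Real.rpow_mul_natCast h0.le]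
      _ ≤ snr k ^ (ρ' * T) := h4.le
      _ = (snr k ^ ρ') ^ T := by rw [Real.rpow_mul_natCast h0.le]
      _ ≤ ((2 : ℝ) ^ (C k).rate) ^ T := by gcongr
      _ = (C k).size := ((C k).size_eq_rpow_rate hT).symm
  refine lt_of_lt_of_le ?_ h6
  have h7 : ENNReal.ofReal (snr k ^ (-c)) < 1 / 2 * ENNReal.ofReal (snr k ^ (-c')) := by
    have e : (1 / 2 : ℝ≥0∞) = ENNReal.ofReal (1 / 2) := by
      rw [ENNReal.ofReal_div_of_pos two_pos]; norm_num
    rw [e, ← ENNReal.ofReal_mul (by norm_num)]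
    refine (ENNReal.ofReal_lt_ofReal_iff (by positivity)).mpr ?_
    linarith
  refine h7.trans_le ?_
  gcongr

theorem frobSq_normDiff_le (C : Code nt T) {s : ℝ} (hs : 0 < s) (hC : C.PowerConstraint s)
    (a b : Fin C.size) : frobSq (C.normDiff s a b) ≤ 4 * (T * nt) := by
  rw [Code.normDiff, frobSq_smul, Complex.norm_real, Real.norm_eq_abs, sq_abs, div_pow, one_pow,
    Real.sq_sqrt hs.le, one_div, inv_mul_le_iff₀ hs]
  have := frobSq_sub_le (C.word a) (C.word b)
  have h1 := hC a
  have h2 := hC b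
  nlinarith

theorem mul_frobSq_mul_normDiff (C : Code nt T) {s : ℝ} (hs : 0 < s)
    (H : Matrix (Fin nr) (Fin nt) ℂ) (a b : Fin C.size) :
    s * frobSq (H * C.normDiff s a b) = frobSq (H * (C.word a - C.word b)) := by
  rw [Code.normDiff, Matrix.mul_smul, frobSq_smul, Complex.norm_real, Real.norm_eq_abs, sq_abs,
    div_pow, one_pow, Real.sq_sqrt hs.le]
  field_simp

/-- Under the product criterion, errors are due to outage only. -/
theorem eventually_lt_decayExponent_errorProb (hn : 0 < min nr nt)
    (hsnr : Tendsto snr atTop atTop) (hpower : ∀ k, (C k).PowerConstraint (snr k))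
    (hrate : Tendsto (fun k => (C k).rate / Real.logb 2 (snr k)) atTop (𝓝 r))
    {e : ℕ → ℝ} (he : e =o[atTop] fun k => Real.logb 2 (snr k))
    (hcrit : ∀ᶠ k in atTop, ∀ a b : Fin (C k).size, a ≠ b →
      1 / (2 : ℝ) ^ ((C k).rate + e k) ≤
        ∏ l ∈ Finset.Icc 1 (min nr nt), smallSingVal ((C k).normDiff (snr k) a b) l ^ 2)
    (μ : Measure (Matrix (Fin nr) (Fin nt) ℂ)) [IsProbabilityMeasure μ] {dout : ℝ → EReal}
    (hout : ∀ᶠ ρ in 𝓝 r, HasOutageExponent μ ρ (dout ρ)) (hcont : ContinuousAt dout r)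
    {c : ℝ} (hc : (c : EReal) < dout r) :
    ∀ᶠ k in atTop, c < decayExponent ((C k).errorProb μ) (snr k) := by
  obtain ⟨c', hcc', hc'd⟩ := EReal.lt_iff_exists_real_btwn.mp hc
  have hcc' : c < c' := by exact_mod_cast hcc'
  obtain ⟨ρ, ⟨hρout, hρd⟩, hρr⟩ :=
    (((hout.and (hcont.eventually_const_lt hc'd)).filter_mono nhdsWithin_le_nhds).and
      (self_mem_nhdsWithin (s := Set.Ioi r))).exists
  have hρr : r < ρ := hρr
  set n := min nr nt with hnn
  have hn' : (0 : ℝ) < n := by exact_mod_cast hn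
  have hn1 : (1 : ℝ) ≤ n := by exact_mod_cast hn
  -- One `γ` pays for the rate exceeding `r`, one for `e k`. The exponent left over is `ρ - (r + 2γ)
  -- = 2γ`, which becomes `θ` after the `n`-th root.
  set γ := (ρ - r) / 4 with hγ
  have hγ0 : 0 < γ := by rw [hγ]; linarith
  set θ := 2 * γ / n with hθ
  have hθ0 : 0 < θ := by positivity
  -- A moment order for which the noise tail at level `s ^ θ` falls below `s ^ (-c')`.
  obtain ⟨p, hp⟩ := exists_nat_gt (c' / θ)
  rw [div_lt_iff₀ hθ0] at hp
  obtain ⟨M, hM0, hM⟩ := exists_noise_tail_le nr T p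
  filter_upwards [hsnr.eventually_gt_atTop 1,
    hsnr.eventually (hρout.eventually_const_lt hρd),
    eventually_two_rpow_rate_le hsnr hrate (ρ := r + γ) (by linarith),
    he.bound hγ0, hcrit,
    -- Then `‖D‖² ≤ 4 T nt` uses up at most half of `s ^ θ`, leaving a squared distance of `s ^ θ /
    -- 2 = 4 (s ^ θ / 8)`.
    hsnr.eventually ((tendsto_rpow_atTop hθ0).eventually_ge_atTop (8 * (T * nt))),
    hsnr.eventually (eventually_mul_rpow_lt_rpow (neg_lt_neg hp) (M * 8 ^ p)),
    hsnr.eventually (eventually_mul_rpow_lt_rpow (neg_lt_neg hcc') 2)]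
    with k h1 h2 h3 h4 h5 h6 h7 h8
  have h0 : 0 < snr k := by linarith
  rw [coe_lt_decayExponent_iff h1] at h2 ⊢
  have hexp : (2 : ℝ) ^ ((C k).rate + e k) ≤ snr k ^ (r + 2 * γ) := by
    rw [Real.rpow_add two_pos, show r + 2 * γ = (r + γ) + γ by ring, Real.rpow_add h0]
    refine mul_le_mul h3 ?_ (by positivity) (by positivity)
    have hl : 0 < Real.logb 2 (snr k) := Real.logb_pos one_lt_two h1
    rw [two_rpow_eq h1]
    refine Real.rpow_le_rpow_of_exponent_le h1.le ?_
    rw [div_le_iff₀ hl]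
    rw [Real.norm_eq_abs, Real.norm_eq_abs, abs_of_pos hl] at h4
    exact (le_abs_self _).trans h4
  have hdist : ∀ H ∉ {H : Matrix (Fin nr) (Fin nt) ℂ |
      Real.logb 2 ((1 + (snr k : ℂ) • (H * Hᴴ)).det.re) < ρ * Real.logb 2 (snr k)},
      ∀ a b, a ≠ b → 4 * (snr k ^ θ / 8) ≤ frobSq (H * ((C k).word a - (C k).word b)) := by
    intro H hH a b hab
    have hH' : snr k ^ ρ ≤ (1 + (snr k : ℂ) • (H * Hᴴ)).det.re := by
      by_contra hcon
      exact hH ((logb_det_lt_iff h1 ρ H).mpr (not_le.mp hcon))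
    have h9 := mul_rpow_det_mul_prod_le hn H ((C k).normDiff (snr k) a b) h0.le
    rw [mul_frobSq_mul_normDiff (C k) h0] at h9
    have h10 := frobSq_normDiff_le (C k) h0 (hpower k) a b
    have h11 : snr k ^ θ ≤ ((1 + (snr k : ℂ) • (H * Hᴴ)).det.re *
      ∏ l ∈ Finset.Icc 1 n, smallSingVal ((C k).normDiff (snr k) a b) l ^ 2) ^ (1 / (n : ℝ)) := by
      calc snr k ^ θ = (snr k ^ ρ * (1 / snr k ^ (r + 2 * γ))) ^ (1 / (n : ℝ)) := by
            rw [one_div (snr k ^ _), ← Real.rpow_neg h0.le, ← Real.rpow_add h0,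
              ← Real.rpow_mul h0.le]
            congr 1
            rw [hθ, hγ]
            ring
        _ ≤ _ := by
            refine Real.rpow_le_rpow (by positivity) ?_ (by positivity)
            refine mul_le_mul hH' ?_ (by positivity) ?_
            · exact (one_div_le_one_div_of_le (by positivity) hexp).trans (h5 a b hab)
            · exact zero_le_one.trans (one_le_det_one_add H h0.le)
    have h12 : snr k ^ θ ≤ n * snr k ^ θ := by
      have : 0 < snr k ^ θ := by positivity
      nlinarith
    have h13 := mul_le_mul_of_nonneg_left h11 hn'.le
    linarith
  refine ((C k).errorProb_le μ _ _ hdist).trans_lt ?_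
  have hnoise := hM (snr k ^ θ / 8) (by positivity)
  have e1 : M / (snr k ^ θ / 8) ^ p = M * 8 ^ p * snr k ^ (-(p * θ)) := by
    rw [div_pow, ← Real.rpow_mul_natCast h0.le, Real.rpow_neg h0.le, mul_comm θ]
    field_simp
  calc _ ≤ ENNReal.ofReal (snr k ^ (-c')) + ENNReal.ofReal (M / (snr k ^ θ / 8) ^ p) :=
        add_le_add h2.le hnoise
    _ = ENNReal.ofReal (snr k ^ (-c') + M / (snr k ^ θ / 8) ^ p) :=
        (ENNReal.ofReal_add (by positivity) (by positivity)).symm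
    _ < ENNReal.ofReal (snr k ^ (-c)) := by
        refine (ENNReal.ofReal_lt_ofReal_iff (by positivity)).mpr ?_
        rw [e1]
        linarith

theorem approximatelyUniversal_of_prod_le (hT : 0 < T) (hn : 0 < min nr nt)
    (hsnr : Tendsto snr atTop atTop) (hpower : ∀ k, (C k).PowerConstraint (snr k))
    (hrate : Tendsto (fun k => (C k).rate / Real.logb 2 (snr k)) atTop (𝓝 r))
    {e : ℕ → ℝ} (he : e =o[atTop] fun k => Real.logb 2 (snr k))
    (hcrit : ∀ᶠ k in atTop, ∀ a b : Fin (C k).size, a ≠ b →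
      1 / (2 : ℝ) ^ ((C k).rate + e k) ≤
        ∏ l ∈ Finset.Icc 1 (min nr nt), smallSingVal ((C k).normDiff (snr k) a b) l ^ 2) :
    ApproximatelyUniversal nr snr C r := by
  intro μ _ dout hout hcont
  refine tendsto_order.mpr ⟨fun x hx => ?_, fun x hx => ?_⟩
  · obtain ⟨c, hxc, hc⟩ := EReal.lt_iff_exists_real_btwn.mp hx
    filter_upwards [eventually_lt_decayExponent_errorProb hn hsnr hpower hrate he hcrit μ hout hcont
      hc] with k hk
    exact hxc.trans hk
  · obtain ⟨c, hc, hcx⟩ := EReal.lt_iff_exists_real_btwn.mp hx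
    filter_upwards [eventually_decayExponent_errorProb_lt hT hsnr hpower hrate μ hout hcont hc]
      with k hk
    exact hk.trans hcx

end Sequence

/-! ### Fading laws with prescribed outage exponents. -/

theorem tendsto_decayExponent_of_bounds {p : ℝ → ℝ≥0∞} {d c₁ c₂ : ℝ} (hc₁ : 0 < c₁)
    (h₁ : ∀ᶠ t in atTop, ENNReal.ofReal (c₁ * t ^ (-d)) ≤ p t)
    (h₂ : ∀ᶠ t in atTop, p t ≤ ENNReal.ofReal (c₂ * t ^ (-d))) :
    Tendsto (fun t => decayExponent (p t) t) atTop (𝓝 (d : EReal)) := by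
  refine tendsto_order.mpr ⟨fun x hx => ?_, fun x hx => ?_⟩
  · obtain ⟨c, hxc, hcd⟩ := EReal.lt_iff_exists_real_btwn.mp hx
    have hcd : c < d := by exact_mod_cast hcd
    filter_upwards [h₂, eventually_gt_atTop 1,
      eventually_mul_rpow_lt_rpow (neg_lt_neg hcd) c₂] with t h2 ht h3
    refine hxc.trans ((coe_lt_decayExponent_iff ht c).mpr (h2.trans_lt ?_))
    exact (ENNReal.ofReal_lt_ofReal_iff (Real.rpow_pos_of_pos (by linarith) _)).mpr h3
  · obtain ⟨c, hdc, hcx⟩ := EReal.lt_iff_exists_real_btwn.mp hx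
    have hdc : d < c := by exact_mod_cast hdc
    filter_upwards [h₁, eventually_gt_atTop 1,
      eventually_mul_rpow_lt_rpow (neg_lt_neg hdc) c₁⁻¹] with t h1 ht h3
    refine lt_trans ((decayExponent_lt_coe_iff ht c).mpr (lt_of_lt_of_le ?_ h1)) hcx
    have ht0 : 0 < t := by linarith
    refine (ENNReal.ofReal_lt_ofReal_iff (by positivity)).mpr ?_
    rwa [inv_mul_lt_iff₀ hc₁] at h3

theorem det_one_add_smul_scalar {nr nt : ℕ} (t h : ℝ) :
    (1 + (t : ℂ) • (((h : ℂ) • (Matrix.of fun i j => if (i : ℕ) = j then (1 : ℂ) else 0 :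
      Matrix (Fin nr) (Fin nt) ℂ)) * ((h : ℂ) • (Matrix.of fun i j => if (i : ℕ) = j then (1 : ℂ)
      else 0 : Matrix (Fin nr) (Fin nt) ℂ))ᴴ)).det.re = (1 + t * h ^ 2) ^ min nr nt := by
  set E : Matrix (Fin nr) (Fin nt) ℂ := Matrix.of fun i j => if (i : ℕ) = j then (1 : ℂ) else 0
    with hE
  have hEE : E * Eᴴ = Matrix.diagonal fun i : Fin nr => if (i : ℕ) < nt then (1 : ℂ) else 0 := by
    ext i k
    rw [Matrix.mul_apply]
    simp only [hE, Matrix.conjTranspose_apply, Matrix.of_apply]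
    by_cases hi : (i : ℕ) < nt
    · rw [Finset.sum_eq_single ⟨i, hi⟩]
      · by_cases hik : i = k
        · subst hik; simp [hi]
        · have : (k : ℕ) ≠ i := fun h => hik (Fin.ext h.symm)
          simp [Matrix.diagonal_apply_ne _ hik, this]
      · intro j _ hj
        have : (i : ℕ) ≠ j := fun h => hj (Fin.ext h.symm)
        simp [this]
      · simp
    · rw [Finset.sum_eq_zero]
      · by_cases hik : i = k
        · subst hik; simp [hi]
        · simp [Matrix.diagonal_apply_ne _ hik]
      · intro j _
        have : (i : ℕ) ≠ j := by have := j.2; omega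
        simp [this]
  have h1 : 1 + (t : ℂ) • (((h : ℂ) • E) * ((h : ℂ) • E)ᴴ) = Matrix.diagonal fun i : Fin nr =>
      ((if (i : ℕ) < nt then 1 + t * h ^ 2 else 1 : ℝ) : ℂ) := by
    rw [Matrix.conjTranspose_smul, Matrix.smul_mul, Matrix.mul_smul, hEE, ← Matrix.diagonal_one,
      ← Matrix.diagonal_smul, ← Matrix.diagonal_smul, ← Matrix.diagonal_smul, Matrix.diagonal_add]
    congr 1
    ext i
    simp only [Pi.smul_apply, smul_eq_mul, Complex.star_def, Complex.conj_ofReal]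
    split_ifs <;> push_cast <;> ring
  rw [h1, Matrix.det_diagonal, ← Complex.ofReal_prod, Complex.ofReal_re, Finset.prod_ite,
    Finset.prod_const, Finset.prod_const_one, mul_one, Fin.card_filter_val_lt]

/-- A scalar fading law with outage exponent `β * (1 - ρ / min nr nt)`. -/
theorem exists_scalar_fading {nr nt : ℕ} (hn : 0 < min nr nt) {β : ℝ} (hβ : 0 < β) :
    ∃ ν : Measure (Matrix (Fin nr) (Fin nt) ℂ), IsProbabilityMeasure ν ∧
      ∀ ρ : ℝ, 0 < ρ → ρ < (min nr nt : ℕ) → ∀ᶠ t in atTop,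
        ENNReal.ofReal (2 ^ (-β) * t ^ (-(β * (1 - ρ / (min nr nt : ℕ))))) ≤ outageProb ν ρ t ∧
        outageProb ν ρ t ≤ ENNReal.ofReal (t ^ (-(β * (1 - ρ / (min nr nt : ℕ))))) := by
  set E : Matrix (Fin nr) (Fin nt) ℂ := Matrix.of fun i j => if (i : ℕ) = j then (1 : ℂ) else 0
    with hE
  -- For `u` uniform on `[0,1]` the gain is `u ^ (1/β)`, and outage means roughly `u ^ (1/β) < t ^
  -- (ρ/n - 1)`.
  set g : ℝ → Matrix (Fin nr) (Fin nt) ℂ := fun u => ((u ^ (1 / (2 * β)) : ℝ) : ℂ) • E with hg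
  have hgm : Measurable g := by
    rw [measurable_matrix_iff]
    intro i j
    simp only [hg, Matrix.smul_apply]
    exact (Complex.measurable_ofReal.comp (measurable_id.pow_const _)).smul_const _
  refine ⟨((volume : Measure ℝ).restrict (Set.Icc 0 1)).map g, ?_, fun ρ hρ0 hρn => ?_⟩
  · have : IsProbabilityMeasure ((volume : Measure ℝ).restrict (Set.Icc 0 1)) :=
      ⟨by rw [Measure.restrict_apply_univ, Real.volume_Icc]; simp⟩
    exact Measure.isProbabilityMeasure_map hgm.aemeasurable
  set n := min nr nt with hnn
  have hn' : (0 : ℝ) < n := by exact_mod_cast hn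
  have hdet : ∀ t u : ℝ, 1 < t → 0 ≤ u →
      (Real.logb 2 ((1 + (t : ℂ) • (g u * (g u)ᴴ)).det.re) < ρ * Real.logb 2 t ↔
        1 + t * u ^ (1 / β) < t ^ (ρ / n)) := by
    intro t u ht hu
    have ht0 : 0 < t := by linarith
    rw [logb_det_lt_iff ht, hg, det_one_add_smul_scalar, ← Real.rpow_mul_natCast hu,
      show t ^ ρ = (t ^ (ρ / n)) ^ n by
        rw [← Real.rpow_mul_natCast ht0.le, div_mul_cancel₀ _ hn'.ne'],
      show 1 / (2 * β) * ((2 : ℕ) : ℝ) = 1 / β by push_cast; field_simp]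
    exact pow_lt_pow_iff_left₀ (by positivity) (by positivity) hn.ne'
  have hexp : ∀ t : ℝ, 0 < t → (t ^ (ρ / n - 1)) ^ β = t ^ (-(β * (1 - ρ / n))) := by
    intro t ht
    rw [← Real.rpow_mul ht.le]
    congr 1
    ring
  have hρn1 : ρ / n - 1 < 0 := by
    rw [sub_neg, div_lt_one hn']; exact hρn
  filter_upwards [eventually_gt_atTop 1,
    -- So that the `1` in `1 + t u ^ (1/β)` takes at most half of `t ^ (ρ/n)`; this is the origin of
    -- `2 ^ (-β)`.
    (tendsto_rpow_atTop (div_pos hρ0 hn')).eventually_ge_atTop 2] with t ht ht2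
  have ht0 : 0 < t := by linarith
  rw [outageProb, Measure.map_apply hgm (measurableSet_outage ρ t),
    Measure.restrict_apply (hgm (measurableSet_outage ρ t))]
  constructor
  · rw [← hexp t ht0, Real.rpow_neg two_pos.le, ← Real.inv_rpow two_pos.le,
      ← Real.mul_rpow (by positivity) (by positivity)]
    set z := 2⁻¹ * t ^ (ρ / n - 1) with hz
    have hz0 : 0 < z := by positivity
    have hz1 : z ≤ 1 := by
      have : t ^ (ρ / n - 1) ≤ 1 := Real.rpow_le_one_of_one_le_of_nonpos ht.le hρn1.le
      rw [hz]; linarith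
    have : (volume : Measure ℝ) (Set.Ico 0 (z ^ β)) = ENNReal.ofReal (z ^ β) := by
      rw [Real.volume_Ico, sub_zero]
    rw [← this]
    refine measure_mono fun u hu => ⟨?_, hu.1, hu.2.le.trans (Real.rpow_le_one hz0.le hz1 hβ.le)⟩
    refine (hdet t u ht hu.1).mpr ?_
    have h1 : u ^ (1 / β) < z := by
      calc u ^ (1 / β) < (z ^ β) ^ (1 / β) :=
            Real.rpow_lt_rpow hu.1 hu.2 (by positivity)
        _ = z := by rw [← Real.rpow_mul hz0.le, mul_one_div_cancel hβ.ne', Real.rpow_one]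
    have h2 : t * z = 2⁻¹ * t ^ (ρ / n) := by
      rw [hz, Real.rpow_sub_one ht0.ne']
      field_simp
    have h3 := mul_lt_mul_of_pos_left h1 ht0
    linarith
  · rw [← hexp t ht0]
    have : (volume : Measure ℝ) (Set.Icc 0 ((t ^ (ρ / n - 1)) ^ β)) =
        ENNReal.ofReal ((t ^ (ρ / n - 1)) ^ β) := by
      rw [Real.volume_Icc, sub_zero]
    rw [← this]
    refine measure_mono ?_
    rintro u ⟨hu, hu0, hu1⟩
    refine ⟨hu0, ?_⟩
    have h1 := (hdet t u ht hu0).mp hu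
    have h2 : u ^ (1 / β) ≤ t ^ (ρ / n - 1) := by
      rw [Real.rpow_sub_one ht0.ne', le_div_iff₀ ht0]
      linarith
    calc u = (u ^ (1 / β)) ^ β := by
          rw [← Real.rpow_mul hu0, one_div_mul_cancel hβ.ne', Real.rpow_one]
      _ ≤ _ := Real.rpow_le_rpow (by positivity) h2 hβ.le

/-- Mixing rare channels `H j` into a fading law, where `H j` has weight `s j ^ (-A)` up to a
summable factor and is in outage only at powers well below `s j`, preserves the outage exponents. -/
theorem exists_mixture {nr nt : ℕ} (ν : Measure (Matrix (Fin nr) (Fin nt) ℂ))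
    [IsProbabilityMeasure ν] (H : ℕ → Matrix (Fin nr) (Fin nt) ℂ) {s : ℕ → ℝ}
    (hs : ∀ j, 2 ^ (j + 2) ≤ s j) {A : ℝ} (hA : 0 ≤ A) :
    ∃ μ : Measure (Matrix (Fin nr) (Fin nt) ℂ), IsProbabilityMeasure μ ∧
      (∀ j, ENNReal.ofReal (s j ^ (-(A + 1))) ≤ μ {H j}) ∧
      ∀ ρ t κ : ℝ, 1 < t → (∀ j, Real.logb 2 ((1 + (t : ℂ) • (H j * (H j)ᴴ)).det.re) <
          ρ * Real.logb 2 t → t ^ κ < s j) →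
        ENNReal.ofReal (1 / 2) * outageProb ν ρ t ≤ outageProb μ ρ t ∧
        outageProb μ ρ t ≤ outageProb ν ρ t + ENNReal.ofReal (t ^ (-(κ * A))) := by
  have hs0 : ∀ j, 0 < s j := fun j => (by positivity : (0 : ℝ) < 2 ^ (j + 2)).trans_le (hs j)
  have hs1 : ∀ j, 1 ≤ s j := fun j => (one_le_pow₀ one_le_two).trans (hs j)
  have hgeom : ∑' j : ℕ, (2⁻¹ : ℝ≥0∞) ^ (j + 2) = 2⁻¹ := by
    have h := ENNReal.tsum_geometric_add_one (2⁻¹ : ℝ≥0∞)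
    rw [ENNReal.one_sub_inv_two, inv_inv, ENNReal.inv_mul_cancel two_ne_zero
      ENNReal.ofNat_ne_top] at h
    simp_rw [show ∀ j : ℕ, (2⁻¹ : ℝ≥0∞) ^ (j + 2) = 2⁻¹ * 2⁻¹ ^ (j + 1) from fun j => pow_succ' _ _]
    rw [ENNReal.tsum_mul_left, h, mul_one]
  -- The geometric factor keeps the total mass of the atoms at most `1/2`, and by `hs` it costs no
  -- more than one power of `s j`.
  set p : ℕ → ℝ≥0∞ := fun j => 2⁻¹ ^ (j + 2) * ENNReal.ofReal (s j ^ (-A)) with hp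
  set q : Measure (Matrix (Fin nr) (Fin nt) ℂ) :=
    Measure.sum fun j => p j • Measure.dirac (H j) with hq
  have hpsum : ∑' j, p j ≤ 2⁻¹ := by
    rw [← hgeom]
    refine ENNReal.tsum_le_tsum fun j => mul_le_of_le_one_right' ?_
    rw [← ENNReal.ofReal_one]
    exact ENNReal.ofReal_le_ofReal
      (Real.rpow_le_one_of_one_le_of_nonpos (hs1 j) (neg_nonpos.mpr hA))
  have hquniv : q Set.univ = ∑' j, p j := by
    rw [hq, Measure.sum_apply _ MeasurableSet.univ]
    simp
  set w := 1 - ∑' j, p j with hw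
  have hw1 : w ≤ 1 := tsub_le_self
  have hw2 : 2⁻¹ ≤ w := by
    rw [← ENNReal.one_sub_inv_two]
    exact tsub_le_tsub_left hpsum 1
  refine ⟨w • ν + q, ⟨?_⟩, fun j => ?_, fun ρ t κ ht hout => ⟨?_, ?_⟩⟩
  · rw [Measure.add_apply, Measure.smul_apply, measure_univ, hquniv, smul_eq_mul, mul_one, hw]
    exact tsub_add_cancel_of_le (hpsum.trans (by simp))
  · calc ENNReal.ofReal (s j ^ (-(A + 1))) ≤ p j := by
          rw [neg_add, Real.rpow_add (hs0 j), ENNReal.ofReal_mul (by have := hs0 j; positivity),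
            mul_comm, Real.rpow_neg_one]
          simp only [hp]
          gcongr
          rw [ENNReal.ofReal_inv_of_pos (hs0 j), ← ENNReal.inv_pow]
          refine ENNReal.inv_le_inv.mpr ?_
          have := ENNReal.ofReal_le_ofReal (hs j)
          rwa [ENNReal.ofReal_pow zero_le_two, ENNReal.ofReal_ofNat] at this
      _ = (p j • Measure.dirac (H j)) {H j} := by
          rw [Measure.smul_apply, Measure.dirac_apply_of_mem (Set.mem_singleton _), smul_eq_mul,
            mul_one]
      _ ≤ q {H j} := by
          rw [hq]
          exact (ENNReal.le_tsum (f := fun i => (p i • Measure.dirac (H i)) {H j}) j).trans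
            (Measure.le_sum_apply _ _)
      _ ≤ (w • ν + q) {H j} := by
          rw [Measure.add_apply]
          exact le_add_self
  · rw [outageProb, outageProb, Measure.add_apply, Measure.smul_apply, smul_eq_mul, one_div,
      ENNReal.ofReal_inv_of_pos two_pos, ENNReal.ofReal_ofNat]
    exact le_add_right (by gcongr)
  · have ht0 : 0 < t := by linarith
    rw [outageProb, outageProb, Measure.add_apply, Measure.smul_apply, smul_eq_mul]
    refine add_le_add (mul_le_of_le_one_left' hw1) ?_
    rw [hq, Measure.sum_apply _ (measurableSet_outage ρ t)]
    -- Only atoms with `t ^ κ < s j` are in outage, and for these `s j ^ (-A) ≤ t ^ (-κ A)`.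
    calc _ ≤ ∑' j : ℕ, (2⁻¹ : ℝ≥0∞) ^ (j + 2) * ENNReal.ofReal (t ^ (-(κ * A))) := by
          refine ENNReal.tsum_le_tsum fun j => ?_
          rw [Measure.smul_apply, Measure.dirac_apply' _ (measurableSet_outage ρ t), smul_eq_mul]
          by_cases hj : H j ∈ {H | Real.logb 2 ((1 + (t : ℂ) • (H * Hᴴ)).det.re) <
              ρ * Real.logb 2 t}
          · rw [Set.indicator_of_mem hj, Pi.one_apply, mul_one]
            simp only [hp]
            gcongr
            rw [← mul_neg, Real.rpow_mul ht0.le]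
            exact Real.rpow_le_rpow_of_nonpos (by positivity) (hout j hj).le (neg_nonpos.mpr hA)
          · rw [Set.indicator_of_notMem hj, mul_zero]
            exact zero_le
      _ ≤ ENNReal.ofReal (t ^ (-(κ * A))) := by
          rw [ENNReal.tsum_mul_right, hgeom]
          exact mul_le_of_le_one_left' (by simp)

/-! ### Necessity of the product criterion. -/

section Sequence

variable {nt nr T : ℕ} {r : ℝ} {snr : ℕ → ℝ} {C : ℕ → Code nt T}

/-- A bad codeword pair yields a channel that is far from outage at powers around `s` and above,
but over which the pair cannot be distinguished. -/
theorem exists_indistinguishing_channel (C : Code nt T) {s σ : ℝ} (hs : 0 < s) {a b : Fin C.size}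
    (hab : ∏ l ∈ Finset.Icc 1 (min nr nt), smallSingVal (C.normDiff s a b) l ^ 2 < s ^ (-σ)) :
    ∃ H : Matrix (Fin nr) (Fin nt) ℂ,
      frobSq (H * (C.word a - C.word b)) ≤ (min nr nt : ℕ) ∧
      ∀ ρ t ρ₁ : ℝ, 1 < t → ρ ≤ ρ₁ → σ < (min nr nt : ℕ) →
        Real.logb 2 ((1 + (t : ℂ) • (H * Hᴴ)).det.re) < ρ * Real.logb 2 t →
        t ^ (((min nr nt : ℕ) - ρ₁) / ((min nr nt : ℕ) - σ)) < s := by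
  obtain ⟨H, hH, hdet⟩ := exists_aligned_channel (C.normDiff s a b) hs hab
  rw [mul_frobSq_mul_normDiff C hs] at hH
  refine ⟨H, hH, fun ρ t ρ₁ ht hρ hσ hout => ?_⟩
  set n := min nr nt
  have ht0 : 0 < t := by linarith
  have h1 := (logb_det_lt_iff ht ρ H).mp hout
  have h2 := ((hdet t ht0.le).trans_lt h1).trans_le (Real.rpow_le_rpow_of_exponent_le ht.le hρ)
  have hσ' : 0 < (n : ℝ) - σ := by linarith
  -- Rearranges `(t/s) ^ n * s ^ σ < t ^ ρ₁`, the aligned channel's determinant bound combined with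
  -- outage.
  have h3 : t ^ ((n : ℝ) - ρ₁) < s ^ ((n : ℝ) - σ) := by
    rw [Real.rpow_sub ht0, Real.rpow_sub hs, Real.rpow_natCast, Real.rpow_natCast,
      div_lt_iff₀ (by positivity)]
    rw [Real.rpow_neg hs.le, div_inv_eq_mul, div_pow, div_mul_eq_mul_div,
      div_lt_iff₀ (by positivity)] at h2
    rw [div_mul_eq_mul_div, lt_div_iff₀ (by positivity)]
    linarith
  calc t ^ (((n : ℝ) - ρ₁) / (n - σ)) = (t ^ ((n : ℝ) - ρ₁)) ^ (1 / ((n : ℝ) - σ)) := by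
        rw [← Real.rpow_mul ht0.le, mul_one_div]
    _ < (s ^ ((n : ℝ) - σ)) ^ (1 / ((n : ℝ) - σ)) :=
        Real.rpow_lt_rpow (by positivity) h3 (by positivity)
    _ = s := by rw [← Real.rpow_mul hs.le, mul_one_div_cancel hσ'.ne', Real.rpow_one]

/-- Infinitely many bad codeword pairs contradict approximate universality. -/
theorem not_approximatelyUniversal_of_frequently (hT : 0 < T) (hr0 : 0 < r)
    (hsnr : Tendsto snr atTop atTop)
    (hrate : Tendsto (fun k => (C k).rate / Real.logb 2 (snr k)) atTop (𝓝 r))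
    {σ : ℝ} (hrσ : r < σ) (hσn : σ < (min nr nt : ℕ))
    (hbad : ∃ᶠ k in atTop, ∃ a b : Fin (C k).size, a ≠ b ∧
      ∏ l ∈ Finset.Icc 1 (min nr nt), smallSingVal ((C k).normDiff (snr k) a b) l ^ 2 <
        snr k ^ (-σ)) :
    ¬ ApproximatelyUniversal nr snr C r := by
  intro huniv
  have hrn : r < (min nr nt : ℕ) := hrσ.trans hσn
  have hn : 0 < min nr nt := by
    by_contra h
    have : min nr nt = 0 := by omega
    rw [this] at hrn
    norm_num at hrn
    linarith
  have hsub : ∀ j : ℕ, ∃ k, j ≤ k ∧ 2 ^ (j + 2) ≤ snr k ∧ 2 ^ (C k).rate ≤ snr k ^ (r + 1) ∧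
      ∃ a b : Fin (C k).size, a ≠ b ∧
      ∏ l ∈ Finset.Icc 1 (min nr nt), smallSingVal ((C k).normDiff (snr k) a b) l ^ 2 <
        snr k ^ (-σ) := by
    intro j
    obtain ⟨k, hk, h1, h2, h3⟩ := (hbad.and_eventually ((eventually_ge_atTop j).and
      ((hsnr.eventually_ge_atTop (2 ^ (j + 2))).and
        (eventually_two_rpow_rate_le hsnr hrate (ρ := r + 1) (by linarith))))).exists
    exact ⟨k, h1, h2, h3, hk⟩
  choose φ hφ hφ2 hφr a b hab hprod using hsub
  have hs0 : ∀ j, 0 < snr (φ j) := fun j =>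
    (by positivity : (0 : ℝ) < 2 ^ (j + 2)).trans_le (hφ2 j)
  choose H hH hHout using fun j =>
    exists_indistinguishing_channel (nr := nr) (C (φ j)) (hs0 j) (hprod j)
  obtain ⟨c, hc, hclose⟩ := Code.exists_le_condErrorProb_of_frobSq_le nr nt T
    (K := (min nr nt : ℕ)) (by positivity)
  set n := min nr nt with hnn
  have hn' : (0 : ℝ) < n := by exact_mod_cast hn
  set ρ₁ := (r + σ) / 2 with hρ₁
  set κ := ((n : ℝ) - ρ₁) / (n - σ) with hκ
  have hκ1 : 1 < κ := by
    rw [hκ, one_lt_div (by linarith), hρ₁]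
    linarith
  -- With `d` below this solves `κ A = d + 1`: the atoms contribute `t ^ (-(d+1))` to outage,
  -- negligible against `t ^ (-d)`. At `s` they cost an error of order `s ^ (-(A+1))` divided by a
  -- code size at most `s ^ ((r+1) T)`, that is `s ^ (-(d-1))`.
  set A := (3 + (r + 1) * T) / (κ - 1) with hA
  have hκ1' : 0 < κ - 1 := by linarith
  have hA0 : 0 < A := by positivity
  set d := A + 2 + (r + 1) * T with hd
  have hd0 : 0 < d := by positivity
  have hκA : κ * A = d + 1 := by
    have : A * (κ - 1) = 3 + (r + 1) * T := div_mul_cancel₀ _ hκ1'.ne'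
    linarith
  have hrn' : 0 < 1 - r / n := by
    rw [sub_pos, div_lt_one hn']; exact hrn
  -- Normalizes the scalar law to have exponent exactly `d` at `r`.
  set β := d / (1 - r / n) with hβ
  have hβ0 : 0 < β := by positivity
  obtain ⟨ν, hν, hνout⟩ := exists_scalar_fading (nr := nr) (nt := nt) hn hβ0
  obtain ⟨μ, hμ, hμH, hμout⟩ := exists_mixture ν H hφ2 hA0.le
  set D : ℝ → ℝ := fun ρ => β * (1 - ρ / n) with hD
  have hDcont : Continuous D := by fun_prop
  have hDr : D r = d := div_mul_cancel₀ _ hrn'.ne'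
  have hout : ∀ᶠ ρ in 𝓝 r, HasOutageExponent μ ρ (D ρ : EReal) := by
    filter_upwards [eventually_gt_nhds hr0, eventually_lt_nhds hrn,
      eventually_lt_nhds (show r < ρ₁ by rw [hρ₁]; linarith),
      hDcont.continuousAt.eventually_lt_const (show D r < d + 1 by rw [hDr]; linarith)]
      with ρ h0 h1 h2 h3
    refine tendsto_decayExponent_of_bounds (c₁ := 1 / 2 * 2 ^ (-β)) (c₂ := 2) (by positivity) ?_ ?_
    · filter_upwards [hνout ρ h0 h1, eventually_gt_atTop 1] with t ht ht1
      refine le_trans ?_ (hμout ρ t κ ht1 fun j hj => hHout j ρ t ρ₁ ht1 h2.le hσn hj).1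
      rw [mul_assoc, ENNReal.ofReal_mul (by norm_num)]
      gcongr
      exact ht.1
    · filter_upwards [hνout ρ h0 h1, eventually_gt_atTop 1] with t ht ht1
      refine (hμout ρ t κ ht1 fun j hj => hHout j ρ t ρ₁ ht1 h2.le hσn hj).2.trans ?_
      have ht0 : 0 < t := by linarith
      rw [two_mul, ENNReal.ofReal_add (by positivity) (by positivity)]
      refine add_le_add ht.2 (ENNReal.ofReal_le_ofReal ?_)
      refine Real.rpow_le_rpow_of_exponent_le ht1.le ?_
      rw [hκA]
      exact neg_le_neg h3.le
  have hdiv := huniv μ hμ (fun ρ => (D ρ : EReal)) hout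
    (continuous_coe_real_ereal.comp hDcont).continuousAt
  have hlarge : ∀ᶠ k in atTop, ((d - 1 / 2 : ℝ) : EReal) <
      decayExponent ((C k).errorProb μ) (snr k) := by
    refine hdiv.eventually_const_lt ?_
    rw [hDr]
    exact EReal.coe_lt_coe_iff.mpr (by linarith)
  have hev := hlarge.and ((hsnr.eventually_gt_atTop 1).and (hsnr.eventually
    (eventually_mul_rpow_lt_rpow (show -(d - 1 / 2) < -(d - 1) by linarith) c⁻¹)))
  obtain ⟨N, hN⟩ := eventually_atTop.mp hev
  obtain ⟨h1, h2, h3⟩ := hN (φ N) (hφ N)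
  rw [coe_lt_decayExponent_iff h2] at h1
  refine absurd h1 (not_lt.mpr ?_)
  set s := snr (φ N) with hs
  have hs0' : 0 < s := hs0 N
  have hsize : (0 : ℝ) < (C (φ N)).size := by exact_mod_cast (C (φ N)).size_pos
  have hsize2 : ((C (φ N)).size : ℝ) ≤ s ^ ((r + 1) * T) := by
    rw [(C (φ N)).size_eq_rpow_rate hT, Real.rpow_mul_natCast hs0'.le]
    exact pow_le_pow_left₀ (by positivity) (hφr N) T
  have h4 := (C (φ N)).mul_measure_le_errorProb μ
    (c := ENNReal.ofReal (c / (C (φ N)).size)) (S := {H N}) fun H' hH' => by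
    rw [Set.mem_singleton_iff.mp hH']
    exact hclose (C (φ N)) (H N) (a N) (b N) (hab N) (hH N)
  calc ENNReal.ofReal (s ^ (-(d - 1 / 2))) ≤
      ENNReal.ofReal (c / (C (φ N)).size * s ^ (-(A + 1))) := by
        refine ENNReal.ofReal_le_ofReal ?_
        rw [inv_mul_lt_iff₀ hc] at h3
        refine h3.le.trans ?_
        rw [div_mul_eq_mul_div, le_div_iff₀ hsize]
        calc c * s ^ (-(d - 1)) * (C (φ N)).size ≤ c * s ^ (-(d - 1)) * s ^ ((r + 1) * T) := by
              gcongr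
          _ = c * s ^ (-(A + 1)) := by
              rw [mul_assoc, ← Real.rpow_add hs0']
              congr 2
              rw [hd]; ring
    _ = ENNReal.ofReal (c / (C (φ N)).size) * ENNReal.ofReal (s ^ (-(A + 1))) :=
        ENNReal.ofReal_mul (by positivity)
    _ ≤ ENNReal.ofReal (c / (C (φ N)).size) * μ {H N} := by
        gcongr
        exact hμH N
    _ ≤ _ := h4

/-- For each `ε > 0`, a violation of the criterion with slack `ε log SNR` for infinitely many `k` is
excluded by the constructed fading law. Taking for `e k` the worst excess over all pairs turns these
estimates, one for each `ε`, into a single little-o sequence. -/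
theorem exists_isLittleO_of_approximatelyUniversal (hT : 0 < T) (hr0 : 0 < r)
    (hr : r < (min nr nt : ℕ)) (hsnr : Tendsto snr atTop atTop)
    (hrate : Tendsto (fun k => (C k).rate / Real.logb 2 (snr k)) atTop (𝓝 r))
    (huniv : ApproximatelyUniversal nr snr C r) :
    ∃ e : ℕ → ℝ, (e =o[atTop] fun k => Real.logb 2 (snr k)) ∧
      ∀ᶠ k in atTop, ∀ a b : Fin (C k).size, a ≠ b →
        1 / (2 : ℝ) ^ ((C k).rate + e k) ≤
          ∏ l ∈ Finset.Icc 1 (min nr nt), smallSingVal ((C k).normDiff (snr k) a b) l ^ 2 := by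
  set P : ∀ k, Fin (C k).size → Fin (C k).size → ℝ := fun k a b =>
    ∏ l ∈ Finset.Icc 1 (min nr nt), smallSingVal ((C k).normDiff (snr k) a b) l ^ 2 with hP
  have key : ∀ ε : ℝ, 0 < ε → ∀ᶠ k in atTop, ∀ a b : Fin (C k).size, a ≠ b →
      1 / (2 : ℝ) ^ ((C k).rate + ε * Real.logb 2 (snr k)) ≤ P k a b := by
    intro ε hε
    by_contra hcon
    rw [not_eventually] at hcon
    -- Half of `ε` covers the convergence of the rate; the other bound keeps `σ = r + δ` below `min
    -- nr nt`.
    set δ := min (ε / 2) (((min nr nt : ℕ) - r) / 2) with hδ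
    have hδ0 : 0 < δ := lt_min (by linarith) (by linarith)
    have hδ1 : δ ≤ ε / 2 := min_le_left _ _
    have hδ2 : δ ≤ ((min nr nt : ℕ) - r) / 2 := min_le_right _ _
    refine not_approximatelyUniversal_of_frequently hT hr0 hsnr hrate (nr := nr) (σ := r + δ)
      (by linarith) (by linarith) ?_ huniv
    refine (hcon.and_eventually ((hsnr.eventually_gt_atTop 1).and
      (eventually_rpow_le_two_rpow_rate hsnr hrate (ρ := r - ε / 2) (by linarith)))).mono ?_
    rintro k ⟨h1, h2, h3⟩
    push Not at h1
    obtain ⟨a, b, hab, h4⟩ := h1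
    have h0 : 0 < snr k := by linarith
    refine ⟨a, b, hab, h4.trans_le ?_⟩
    have hl : Real.logb 2 (snr k) ≠ 0 := (Real.logb_pos one_lt_two h2).ne'
    rw [Real.rpow_neg h0.le, ← one_div]
    refine one_div_le_one_div_of_le (by positivity) ?_
    rw [Real.rpow_add two_pos, two_rpow_eq h2 (ε * _), mul_div_cancel_right₀ _ hl]
    calc snr k ^ (r + δ) ≤ snr k ^ ((r - ε / 2) + ε) :=
          Real.rpow_le_rpow_of_exponent_le h2.le (by linarith)
      _ = snr k ^ (r - ε / 2) * snr k ^ ε := Real.rpow_add h0 _ _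
      _ ≤ _ := by gcongr
  set f : ∀ k, Fin (C k).size × Fin (C k).size → ℝ := fun k p =>
    if p.1 = p.2 then 0 else max 0 (-Real.logb 2 (P k p.1 p.2) - (C k).rate) with hf
  have hf0 : ∀ k p, 0 ≤ f k p := fun k p => by
    simp only [hf]; split_ifs <;> simp
  refine ⟨fun k => ⨆ p, f k p, ?_, ?_⟩
  · rw [isLittleO_iff]
    intro ε hε
    filter_upwards [key ε hε, hsnr.eventually_gt_atTop 1] with k h1 h2
    have hl : 0 < Real.logb 2 (snr k) := Real.logb_pos one_lt_two h2
    rw [Real.norm_of_nonneg (Real.iSup_nonneg (hf0 k)), Real.norm_of_nonneg hl.le]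
    refine Real.iSup_le (fun p => ?_) (by positivity)
    simp only [hf]
    split_ifs with h
    · positivity
    · refine max_le (by positivity) ?_
      have h3 := Real.logb_le_logb_of_le one_lt_two (by positivity) (h1 p.1 p.2 h)
      rw [one_div, Real.logb_inv, Real.logb_rpow two_pos (by norm_num)] at h3
      linarith
  -- The bound with `ε = 1` serves only to make the product positive, since `Real.logb 2 0 = 0`
  -- would make `f` meaningless there.
  · filter_upwards [key 1 one_pos] with k h1 a b hab
    have hP0 : 0 < P k a b := lt_of_lt_of_le (by positivity) (h1 a b hab)
    have h2 : f k (a, b) ≤ ⨆ p, f k p := le_ciSup (Set.finite_range _).bddAbove _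
    have h3 : -Real.logb 2 (P k a b) - (C k).rate ≤ f k (a, b) := by
      simp only [hf, if_neg hab]
      exact le_max_right _ _
    rw [one_div, ← Real.rpow_neg two_pos.le]
    calc (2 : ℝ) ^ (-((C k).rate + ⨆ p, f k p)) ≤ 2 ^ Real.logb 2 (P k a b) :=
          Real.rpow_le_rpow_of_exponent_le one_le_two (by linarith)
      _ = P k a b := Real.rpow_logb two_pos (by norm_num) hP0

end Sequence

end MIMO

theorem theorem1 (nt nr T : ℕ) (hT : 0 < T)
    (r : ℝ) (hr0 : 0 < r) (hr : r < (min nr nt : ℕ))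
    (snr : ℕ → ℝ) (hsnr_pos : ∀ k, 0 < snr k) (hsnr : Tendsto snr atTop atTop)
    (C : ℕ → MIMO.Code nt T) (hpower : ∀ k, (C k).PowerConstraint (snr k))
    (hrate : Tendsto (fun k => (C k).rate / Real.logb 2 (snr k)) atTop (𝓝 r)) :
    MIMO.ApproximatelyUniversal nr snr C r ↔
      ∃ e : ℕ → ℝ, (e =o[atTop] fun k => Real.logb 2 (snr k)) ∧
        ∀ᶠ k in atTop, ∀ a b : Fin (C k).size, a ≠ b →
          1 / (2 : ℝ) ^ ((C k).rate + e k) ≤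
            ∏ l ∈ Finset.Icc 1 (min nr nt),
              MIMO.smallSingVal ((C k).normDiff (snr k) a b) l ^ 2 := by
  have hn : 0 < min nr nt := by exact_mod_cast hr0.trans hr
  constructor
  · exact MIMO.exists_isLittleO_of_approximatelyUniversal hT hr0 hr hsnr hrate
  · rintro ⟨e, he, hcrit⟩
    exact MIMO.approximatelyUniversal_of_prod_le hT hn hsnr hpower hrate he hcrit
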